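/- Let $n\in\mathbb N_0$. Let $\mathcal K_1(\mathbb R^n)$ be the space of all $\varphi\in C^\infty(\mathbb R^n)$ such that $\nu_k(\varphi)=\sup_{t\in\mathbb R^n,\,|\alpha|\le k}e^{k|t|}|\varphi^{(\alpha)}(t)|<\infty$ for every $k\in\mathbb N_0$, with the topology given by the norms $\nu_k$, and let $\mathcal K_1'(\mathbb R^n)$ be its strong dual. Let $\Pi_k=\mathbb R^n+i[-k,k]^n$, and let $\mathcal K_1(\mathbb R^n)\widehat\otimes\,\mathcal U(\mathbb C^n)$ be the space of all functions $\Phi(x,z)$ on $\mathbb R^n\times\mathbb C^n$, smooth in $x$ and entire in $z$, such that $$\rho_k(\Phi)=\sup_{x\in\mathbb R^n,\;z\in\Pi_k,\;|\alpha|\le k}e^{k|x|}(1+|z|^2)^{k/2}\left|\partial_x^\alpha\Phi(x,z)\right|<\infty\qquad(k\in\mathbb N_0),$$ with the topology given by the norms $\rho_k$; its strong dual is denoted by $\mathcal K_1'(\mathbb R^n)\widehat\otimes\,\mathcal U'(\mathbb C^n)$. For $f\in\mathcal K_1'(\mathbb R^n)$, $\psi\in\mathcal K_1(\mathbb R^n)$,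 $x\in\mathbb R^n$ and $z\in\mathbb C^n$ put $$V_\psi f(x,z)=\big\langle f(t),\,\overline{\psi(t-x)}\,e^{-2\pi i z\cdot t}\big\rangle_t ,$$ and for $\varphi\in\mathcal K_1(\mathbb R^n)$ put $V_\psi\varphi(x,z)=\int_{\mathbb R^n}\varphi(t)\overline{\psi(t-x)}e^{-2\pi i z\cdot t}\,dt$. Let $(\gamma,\psi)_{L^2}=\int_{\mathbb R^n}\gamma(t)\overline{\psi(t)}\,dt$. **Theorem.** (a) For all $f\in\mathcal K_1'(\mathbb R^n)$ and $\psi\in\mathcal K_1(\mathbb R^n)$ the absolutely convergent integrals $$\langle V_\psi f,\Phi\rangle=\iint_{\mathbb R^{2n}}V_\psi f(x,\xi)\,\Phi(x,\xi)\,dx\,d\xi,\qquad \Phi\in\mathcal K_1(\mathbb R^n)\widehat\otimes\,\mathcal U(\mathbb C^n),$$ define an element $V_\psi f$ of $\mathcal K_1'(\mathbb R^n)\widehat\otimes\,\mathcal U'(\mathbb C^n)$, and the sesquilinear map $$V:\mathcal K_1'(\mathbb R^n)\times\mathcal K_1(\mathbb R^n)\to\mathcal K_1'(\mathbb R^n)\widehat\otimes\,\mathcal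 U'(\mathbb C^n),\qquad (f,\psi)\mapsto V_\psi f,$$ is hypocontinuous. (b) For all $F\in\mathcal K_1'(\mathbb R^n)\widehat\otimes\,\mathcal U'(\mathbb C^n)$ and $\psi\in\mathcal K_1(\mathbb R^n)$ the formula $$\langle V_\psi^*F,\varphi\rangle=\big\langle F,\overline{V_\psi\overline\varphi}\big\rangle,\qquad\varphi\in\mathcal K_1(\mathbb R^n),$$ in which $\overline{V_\psi\overline\varphi}$ stands for the element $(x,z)\mapsto\overline{V_\psi\overline\varphi(x,\overline z)}$ of $\mathcal K_1(\mathbb R^n)\widehat\otimes\,\mathcal U(\mathbb C^n)$, defines an element $V_\psi^*F$ of $\mathcal K_1'(\mathbb R^n)$, and the bilinear map $$V^*:\big(\mathcal K_1'(\mathbb R^n)\widehat\otimes\,\mathcal U'(\mathbb C^n)\big)\times\mathcal K_1(\mathbb R^n)\to\mathcal K_1'(\mathbb R^n),\qquad(F,\psi)\mapsto V_\psi^*F,$$ is hypocontinuous. (c) Let $\psi\in\mathcal K_1(\mathbb R^n)\setminus\{0\}$ and let $\gamma\in\mathcal K_1(\mathbb R^n)$ be a synthesis window for $\psi$, that is,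 $(\gamma,\psi)_{L^2}\ne0$. Then $$\frac1{(\gamma,\psi)_{L^2}}\,V_\gamma^*V_\psi=\mathrm{id}_{\mathcal K_1'(\mathbb R^n)},$$ and, for all $f\in\mathcal K_1'(\mathbb R^n)$, $\varphi\in\mathcal K_1(\mathbb R^n)$ and $\eta\in\mathbb R^n$, $$\langle f,\varphi\rangle=\frac1{(\gamma,\psi)_{L^2}}\iint_{\mathbb R^{2n}}V_\psi f(x,\xi+i\eta)\,V_{\overline\gamma}\varphi(x,-\xi-i\eta)\,dx\,d\xi ,$$ the integral being absolutely convergent. Here a sesquilinear or bilinear map $\beta:E\times F\to G$ is hypocontinuous if for every bounded $B\subset E$ the maps $\beta(x,\cdot)$, $x\in B$, are equicontinuous, and for every bounded $B\subset F$ the maps $\beta(\cdot,y)$, $y\in B$, are equicontinuous. -/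

import Mathlib

open MeasureTheory Topology
open scoped ContDiff ComplexConjugate

noncomputable section

namespace ExpSTFT

/-- The space `ℝⁿ` with its Euclidean norm. -/
abbrev RSp (n : ℕ) : Type := EuclideanSpace ℝ (Fin n)

/-- The space `ℂⁿ` with its Hermitian norm. -/
abbrev CSp (n : ℕ) : Type := EuclideanSpace ℂ (Fin n)

/-- The point `ξ + i η` of `ℂⁿ`. -/
def cpt {n : ℕ} (ξ η : RSp n) : CSp n :=
  WithLp.toLp 2 fun i => (ξ i : ℂ) + (η i : ℂ) * Complex.I

/-- The coordinatewise complex conjugate of a point of `ℂⁿ`. -/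
def conjPt {n : ℕ} (z : CSp n) : CSp n := WithLp.toLp 2 fun i => conj (z i)

/-- The bilinear product `z · t = z₁ t₁ + … + zₙ tₙ` of `z ∈ ℂⁿ` and `t ∈ ℝⁿ`. -/
def cdot {n : ℕ} (z : CSp n) (t : RSp n) : ℂ := ∑ i, z i * (t i : ℂ)

/-- The tube `Π_k = ℝⁿ + i [-k, k]ⁿ`. -/
def tube (n k : ℕ) : Set (CSp n) := {z | ∀ i, |(z i).im| ≤ k}

lemma ciSup_add_bound {ι : Type*} [Nonempty ι] {f g h : ι → ℝ} (hle : ∀ i, f i ≤ g i + h i)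
    (hg : BddAbove (Set.range g)) (hh : BddAbove (Set.range h)) :
    ⨆ i, f i ≤ (⨆ i, g i) + ⨆ i, h i :=
  ciSup_le fun i => (hle i).trans (add_le_add (le_ciSup hg i) (le_ciSup hh i))

/-! ### The test function space `𝒦₁(ℝⁿ)` -/

/-- The weighted derivative `e^{k|t|} |φ^{(j)}(t)|`, where `φ^{(j)}(t)` is the full derivative of
order `j`, measured in the operator norm (which is equivalent to the largest modulus of the
partial derivatives of order `j`). -/
def wder {n : ℕ} (k : ℕ) (φ : RSp n → ℂ) (j : ℕ) (t : RSp n) : ℝ :=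
  Real.exp (k * ‖t‖) * ‖iteratedFDeriv ℝ j φ t‖

lemma wder_add {n : ℕ} (k : ℕ) {φ χ : RSp n → ℂ} (hφ : ContDiff ℝ ∞ φ) (hχ : ContDiff ℝ ∞ χ)
    (j : ℕ) (t : RSp n) : wder k (φ + χ) j t ≤ wder k φ j t + wder k χ j t := by
  unfold wder
  rw [iteratedFDeriv_add_apply (hφ.of_le (by exact_mod_cast le_top)).contDiffAt
    (hχ.of_le (by exact_mod_cast le_top)).contDiffAt, ← mul_add]
  gcongr
  exact norm_add_le _ _

lemma wder_smul {n : ℕ} (k : ℕ) (c : ℂ) {φ : RSp n → ℂ} (hφ : ContDiff ℝ ∞ φ)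
    (j : ℕ) (t : RSp n) : wder k (c • φ) j t = ‖c‖ * wder k φ j t := by
  unfold wder
  rw [iteratedFDeriv_const_smul_apply (hφ.of_le (by exact_mod_cast le_top)).contDiffAt, norm_smul]
  ring

/-- The smooth functions on `ℝⁿ` all of whose norms `ν_k` are finite. -/
def k1Submodule (n : ℕ) : Submodule ℂ (RSp n → ℂ) where
  carrier := {φ | ContDiff ℝ ∞ φ ∧ ∀ k : ℕ, ∃ C : ℝ, ∀ j ≤ k, ∀ t, wder k φ j t ≤ C}
  zero_mem' := ⟨contDiff_const, fun k => ⟨0, fun j _ t => by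
    have := wder_smul k 0 (φ := (0 : RSp n → ℂ)) contDiff_const j t
    simpa using this.le⟩⟩
  add_mem' := by
    rintro φ χ ⟨hφ, bφ⟩ ⟨hχ, bχ⟩
    refine ⟨hφ.add hχ, fun k => ?_⟩
    obtain ⟨C, hC⟩ := bφ k
    obtain ⟨D, hD⟩ := bχ k
    exact ⟨C + D, fun j hj t => (wder_add k hφ hχ j t).trans (add_le_add (hC j hj t) (hD j hj t))⟩
  smul_mem' := by
    rintro c φ ⟨hφ, bφ⟩
    refine ⟨hφ.const_smul c, fun k => ?_⟩
    obtain ⟨C, hC⟩ := bφ k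
    refine ⟨‖c‖ * C, fun j hj t => ?_⟩
    rw [wder_smul k c hφ]
    exact mul_le_mul_of_nonneg_left (hC j hj t) (norm_nonneg c)

/-- The space `𝒦₁(ℝⁿ)` of exponentially rapidly decreasing smooth functions. -/
def K1 (n : ℕ) : Type := k1Submodule n

instance (n : ℕ) : AddCommGroup (K1 n) := inferInstanceAs (AddCommGroup (k1Submodule n))

instance (n : ℕ) : Module ℂ (K1 n) := inferInstanceAs (Module ℂ (k1Submodule n))

instance (n : ℕ) : FunLike (K1 n) (RSp n) ℂ where
  coe φ := φ.1
  coe_injective _ _ h := Subtype.ext h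

namespace K1

lemma bdd {n : ℕ} (φ : K1 n) (k : ℕ) :
    BddAbove (Set.range fun p : Fin (k + 1) × RSp n => wder k φ p.1 p.2) := by
  obtain ⟨C, hC⟩ := φ.2.2 k
  exact ⟨C, by rintro _ ⟨p, rfl⟩; exact hC p.1 (Nat.lt_succ_iff.mp p.1.2) p.2⟩

/-- The norm `ν_k(φ) = sup e^{k|t|} |φ^{(j)}(t)|` over `t ∈ ℝⁿ` and `j ≤ k`. -/
def nu (n k : ℕ) : Seminorm ℂ (K1 n) :=
  Seminorm.ofSMulLE (fun φ => ⨆ p : Fin (k + 1) × RSp n, wder k φ p.1 p.2)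
    (by
      have : ∀ p : Fin (k + 1) × RSp n, wder k ((0 : K1 n) : RSp n → ℂ) p.1 p.2 = 0 := fun p => by
        have := wder_smul k 0 (φ := (0 : RSp n → ℂ)) contDiff_const p.1 p.2
        simp only [zero_smul, norm_zero, zero_mul] at this
        exact this
      simp only [this, ciSup_const])
    (fun φ χ => ciSup_add_bound (fun p => wder_add k φ.2.1 χ.2.1 p.1 p.2) (φ.bdd k) (χ.bdd k))
    (fun c φ => ciSup_le fun p => (wder_smul k c φ.2.1 p.1 p.2).le.trans
      (mul_le_mul_of_nonneg_left (le_ciSup (φ.bdd k) p) (norm_nonneg c)))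

/-- The family of norms `ν_k`, `k ∈ ℕ`. -/
def nuFamily (n : ℕ) : SeminormFamily ℂ (K1 n) ℕ := fun k => nu n k

/-- `𝒦₁(ℝⁿ)` carries the locally convex topology given by the norms `ν_k`. -/
instance (n : ℕ) : TopologicalSpace (K1 n) := (nuFamily n).moduleFilterBasis.topology

lemma withSeminorms (n : ℕ) : WithSeminorms (nuFamily n) := ⟨rfl⟩

instance (n : ℕ) : IsTopologicalAddGroup (K1 n) :=
  (nuFamily n).addGroupFilterBasis.isTopologicalAddGroup

instance (n : ℕ) : ContinuousSMul ℂ (K1 n) := (nuFamily n).moduleFilterBasis.continuousSMul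

end K1

/-- The space `𝒦₁'(ℝⁿ)` of distributions of exponential type: the dual of `𝒦₁(ℝⁿ)` with the strong
topology (uniform convergence on bounded sets). -/
abbrev K1Dual (n : ℕ) : Type := K1 n →L[ℂ] ℂ

/-! ### The test function space `𝒦₁(ℝⁿ) ⊗̂ 𝒰(ℂⁿ)` -/

/-- The weighted derivative `e^{k|x|} (1 + |z|²)^{k/2} |∂ₓ^{(j)} Φ(x, z)|`. -/
def wderU {n : ℕ} (k : ℕ) (Φ : RSp n → CSp n → ℂ) (j : ℕ) (x : RSp n) (z : CSp n) : ℝ :=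
  (1 + ‖z‖ ^ 2) ^ ((k : ℝ) / 2) * wder k (fun y => Φ y z) j x

/-- The functions `Φ(x, z)` on `ℝⁿ × ℂⁿ`, smooth in `x` and entire in `z`, all of whose norms `ρ_k`
are finite. (Finiteness of these norms makes such a `Φ` jointly smooth, and its `x`-derivatives
entire in `z`.) -/
def kuSubmodule (n : ℕ) : Submodule ℂ (RSp n → CSp n → ℂ) where
  carrier := {Φ | (∀ z, ContDiff ℝ ∞ fun x => Φ x z) ∧ (∀ x, Differentiable ℂ (Φ x)) ∧
    ∀ k : ℕ, ∃ C : ℝ, ∀ j ≤ k, ∀ x, ∀ z ∈ tube n k, wderU k Φ j x z ≤ C}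
  zero_mem' := ⟨fun _ => contDiff_const, fun _ => differentiable_const _, fun k => ⟨0,
    fun j _ x z _ => by
      have := wder_smul k 0 (φ := (0 : RSp n → ℂ)) contDiff_const j x
      simp only [zero_smul, norm_zero, zero_mul] at this
      exact (mul_eq_zero_of_right _ this).le⟩⟩
  add_mem' := by
    rintro Φ Ψ ⟨hΦ, eΦ, bΦ⟩ ⟨hΨ, eΨ, bΨ⟩
    refine ⟨fun z => (hΦ z).add (hΨ z), fun x => (eΦ x).add (eΨ x), fun k => ?_⟩
    obtain ⟨C, hC⟩ := bΦ k
    obtain ⟨D, hD⟩ := bΨ k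
    refine ⟨C + D, fun j hj x z hz => le_trans ?_ (add_le_add (hC j hj x z hz) (hD j hj x z hz))⟩
    unfold wderU
    rw [← mul_add]
    exact mul_le_mul_of_nonneg_left (wder_add k (hΦ z) (hΨ z) j x) (by positivity)
  smul_mem' := by
    rintro c Φ ⟨hΦ, eΦ, bΦ⟩
    refine ⟨fun z => (hΦ z).const_smul c, fun x => (eΦ x).const_smul c, fun k => ?_⟩
    obtain ⟨C, hC⟩ := bΦ k
    refine ⟨‖c‖ * C, fun j hj x z hz => le_trans ?_
      (mul_le_mul_of_nonneg_left (hC j hj x z hz) (norm_nonneg c))⟩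
    have := wder_smul k c (hΦ z) j x
    exact ((congrArg _ this).trans (mul_left_comm _ _ _)).le

/-- The space `𝒦₁(ℝⁿ) ⊗̂ 𝒰(ℂⁿ)`, realized as a space of functions on `ℝⁿ × ℂⁿ`. -/
def KU (n : ℕ) : Type := kuSubmodule n

instance (n : ℕ) : AddCommGroup (KU n) := inferInstanceAs (AddCommGroup (kuSubmodule n))

instance (n : ℕ) : Module ℂ (KU n) := inferInstanceAs (Module ℂ (kuSubmodule n))

instance (n : ℕ) : FunLike (KU n) (RSp n) (CSp n → ℂ) where
  coe Φ := Φ.1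
  coe_injective _ _ h := Subtype.ext h

namespace KU

instance (n k : ℕ) : Nonempty (tube n k) := ⟨⟨0, fun i => by simp⟩⟩

lemma bdd {n : ℕ} (Φ : KU n) (k : ℕ) : BddAbove (Set.range
    fun p : Fin (k + 1) × RSp n × tube n k => wderU k Φ p.1 p.2.1 p.2.2) := by
  obtain ⟨C, hC⟩ := Φ.2.2.2 k
  exact ⟨C, by rintro _ ⟨p, rfl⟩; exact hC p.1 (Nat.lt_succ_iff.mp p.1.2) p.2.1 _ p.2.2.2⟩

lemma wderU_add {n : ℕ} (k : ℕ) (Φ Ψ : KU n) (j : ℕ) (x : RSp n) (z : CSp n) :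
    wderU k (Φ + Ψ : KU n) j x z ≤ wderU k Φ j x z + wderU k Ψ j x z := by
  unfold wderU
  rw [← mul_add]
  exact mul_le_mul_of_nonneg_left (wder_add k (Φ.2.1 z) (Ψ.2.1 z) j x) (by positivity)

lemma wderU_smul {n : ℕ} (k : ℕ) (c : ℂ) (Φ : KU n) (j : ℕ) (x : RSp n) (z : CSp n) :
    wderU k (c • Φ : KU n) j x z = ‖c‖ * wderU k Φ j x z :=
  (congrArg _ (wder_smul k c (Φ.2.1 z) j x)).trans (mul_left_comm _ _ _)

/-- The norm `ρ_k(Φ) = sup e^{k|x|} (1 + |z|²)^{k/2} |∂ₓ^{(j)} Φ(x, z)|` over `x ∈ ℝⁿ`, `z ∈ Π_k` and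
`j ≤ k`. -/
def rho (n k : ℕ) : Seminorm ℂ (KU n) :=
  Seminorm.ofSMulLE (fun Φ => ⨆ p : Fin (k + 1) × RSp n × tube n k, wderU k Φ p.1 p.2.1 p.2.2)
    (by
      have : ∀ p : Fin (k + 1) × RSp n × tube n k,
          wderU k ((0 : KU n) : RSp n → CSp n → ℂ) p.1 p.2.1 p.2.2 = 0 := fun p => by
        have := wderU_smul k 0 (0 : KU n) p.1 p.2.1 p.2.2
        rwa [zero_smul, norm_zero, zero_mul] at this
      simp only [this, ciSup_const])
    (fun Φ Ψ => ciSup_add_bound (fun p => wderU_add k Φ Ψ p.1 p.2.1 p.2.2) (Φ.bdd k) (Ψ.bdd k))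
    (fun c Φ => ciSup_le fun p => (wderU_smul k c Φ p.1 p.2.1 p.2.2).le.trans
      (mul_le_mul_of_nonneg_left (le_ciSup (Φ.bdd k) p) (norm_nonneg c)))

/-- The family of norms `ρ_k`, `k ∈ ℕ`. -/
def rhoFamily (n : ℕ) : SeminormFamily ℂ (KU n) ℕ := fun k => rho n k

/-- `𝒦₁(ℝⁿ) ⊗̂ 𝒰(ℂⁿ)` carries the locally convex topology given by the norms `ρ_k`. -/
instance (n : ℕ) : TopologicalSpace (KU n) := (rhoFamily n).moduleFilterBasis.topology

lemma withSeminorms (n : ℕ) : WithSeminorms (rhoFamily n) := ⟨rfl⟩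

instance (n : ℕ) : IsTopologicalAddGroup (KU n) :=
  (rhoFamily n).addGroupFilterBasis.isTopologicalAddGroup

instance (n : ℕ) : ContinuousSMul ℂ (KU n) := (rhoFamily n).moduleFilterBasis.continuousSMul

end KU

/-- The space `𝒦₁'(ℝⁿ) ⊗̂ 𝒰'(ℂⁿ) = (𝒦₁(ℝⁿ) ⊗̂ 𝒰(ℂⁿ))'`, with the strong dual topology. -/
abbrev KUDual (n : ℕ) : Type := KU n →L[ℂ] ℂ

/-! ### The short-time Fourier transform -/

/-- The exponential `t ↦ e^{-2π i z · t}`. -/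
def cexpo {n : ℕ} (z : CSp n) (t : RSp n) : ℂ :=
  Complex.exp (-2 * Real.pi * Complex.I * cdot z t)

/-- The real-linear form `t ↦ -2π i z · t`. -/
def expoForm {n : ℕ} (z : CSp n) : RSp n →L[ℝ] ℂ :=
  ∑ i, (EuclideanSpace.proj i : RSp n →L[ℝ] ℝ).smulRight
    (-2 * Real.pi * Complex.I * z i)

lemma cexpo_eq {n : ℕ} (z : CSp n) : cexpo z = fun t => Complex.exp (expoForm z t) := by
  funext t
  simp only [cexpo, cdot, expoForm, Finset.mul_sum, sum_apply,
    ContinuousLinearMap.smulRight_apply, PiLp.proj_apply, Complex.real_smul]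
  congr 1
  exact Finset.sum_congr rfl fun i _ => by ring

lemma contDiff_cexpo {n : ℕ} (z : CSp n) : ContDiff ℝ ∞ (cexpo z) := by
  rw [cexpo_eq]
  exact (expoForm z).contDiff.cexp

lemma norm_iteratedFDeriv_cexpo {n : ℕ} (z : CSp n) (m : ℕ) (t : RSp n) :
    ‖iteratedFDeriv ℝ m (cexpo z) t‖ ≤ ‖expoForm z‖ ^ m * Real.exp (‖expoForm z‖ * ‖t‖) := by
  induction m generalizing t with
  | zero =>
    rw [norm_iteratedFDeriv_zero, cexpo_eq, Complex.norm_exp, pow_zero, one_mul]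
    exact Real.exp_le_exp.mpr (((Complex.re_le_norm _).trans ((expoForm z).le_opNorm t)))
  | succ m ih =>
    have hd : fderiv ℝ (cexpo z) =
        (ContinuousLinearMap.toSpanSingleton ℂ (expoForm z)).restrictScalars ℝ ∘ cexpo z := by
      funext s
      rw [cexpo_eq]
      simpa using ((expoForm z).hasFDerivAt (x := s)).cexp.fderiv
    rw [← norm_iteratedFDeriv_fderiv, hd]
    refine (ContinuousLinearMap.norm_iteratedFDeriv_comp_left _ (N := ∞)
      (contDiff_cexpo z).contDiffAt (by exact_mod_cast le_top)).trans ?_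
    rw [ContinuousLinearMap.norm_restrictScalars, ContinuousLinearMap.norm_toSpanSingleton, pow_succ']
    rw [mul_assoc]
    exact mul_le_mul_of_nonneg_left (ih t) (norm_nonneg _)

lemma atom_mem {n : ℕ} (ψ : K1 n) (x : RSp n) (z : CSp n) :
    (fun t => conj (ψ (t - x)) * cexpo z t) ∈ k1Submodule n := by
  have hs : ContDiff ℝ ∞ (fun t => conj (ψ (t - x))) :=
    Complex.conjCLE.contDiff.comp (ψ.2.1.comp (contDiff_id.sub contDiff_const))
  refine ⟨hs.mul (contDiff_cexpo z), fun k => ?_⟩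
  set L := ‖expoForm z‖ with hL
  obtain ⟨K, hK⟩ := exists_nat_ge ((k : ℝ) + L)
  have hkK : k ≤ K := by
    have : (k : ℝ) ≤ K := by linarith [norm_nonneg (expoForm z)]
    exact_mod_cast this
  obtain ⟨C, hC⟩ := ψ.2.2 K
  refine ⟨∑ j ∈ Finset.range (k + 1), ∑ i ∈ Finset.range (j + 1),
    (j.choose i : ℝ) * (Real.exp (K * ‖x‖) * C * L ^ (j - i)), fun j hj t => ?_⟩
  have hC0 : 0 ≤ C := le_trans (by unfold wder; positivity) (hC 0 (Nat.zero_le _) 0)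
  have key : wder k (fun t => conj (ψ (t - x)) * cexpo z t) j t ≤
      ∑ i ∈ Finset.range (j + 1),
        (j.choose i : ℝ) * (Real.exp (K * ‖x‖) * C * L ^ (j - i)) := by
    unfold wder
    refine (mul_le_mul_of_nonneg_left (norm_iteratedFDeriv_mul_le hs (contDiff_cexpo z) t
      (by exact_mod_cast le_top)) (Real.exp_pos _).le).trans ?_
    rw [Finset.mul_sum]
    refine Finset.sum_le_sum fun i hi => ?_
    have hi' : i ≤ K := by have := Finset.mem_range.mp hi; omega
    have h1 : ‖iteratedFDeriv ℝ i (fun t => conj (ψ (t - x))) t‖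
        = ‖iteratedFDeriv ℝ i ψ (t - x)‖ := by
      have := Complex.conjLIE.norm_iteratedFDeriv_comp_left (𝕜 := ℝ) (fun t => ψ (t - x)) t i
      rw [iteratedFDeriv_comp_sub] at this
      exact this
    have h2 := hC i hi' (t - x)
    have h3 := norm_iteratedFDeriv_cexpo z (j - i) t
    rw [← hL] at h3
    unfold wder at h2
    have h4 : Real.exp (k * ‖t‖) * Real.exp (L * ‖t‖) ≤
        Real.exp (K * ‖x‖) * Real.exp (K * ‖t - x‖) := by
      rw [← Real.exp_add, ← Real.exp_add, ← add_mul, ← mul_add]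
      refine Real.exp_le_exp.mpr (mul_le_mul hK ?_ (norm_nonneg _) (Nat.cast_nonneg _))
      calc ‖t‖ = ‖x + (t - x)‖ := by congr 1; abel
        _ ≤ _ := norm_add_le _ _
    rw [h1]
    have hLn : 0 ≤ L := norm_nonneg _
    calc Real.exp (k * ‖t‖) * ((j.choose i : ℝ) * ‖iteratedFDeriv ℝ i ψ (t - x)‖ *
          ‖iteratedFDeriv ℝ (j - i) (cexpo z) t‖)
        ≤ Real.exp (k * ‖t‖) * ((j.choose i : ℝ) * ‖iteratedFDeriv ℝ i ψ (t - x)‖ *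
          (L ^ (j - i) * Real.exp (L * ‖t‖))) := by gcongr
      _ = (j.choose i : ℝ) * ((Real.exp (k * ‖t‖) * Real.exp (L * ‖t‖)) *
          ‖iteratedFDeriv ℝ i ψ (t - x)‖ * L ^ (j - i)) := by ring
      _ ≤ (j.choose i : ℝ) * ((Real.exp (K * ‖x‖) * Real.exp (K * ‖t - x‖)) *
          ‖iteratedFDeriv ℝ i ψ (t - x)‖ * L ^ (j - i)) := by gcongr
      _ = (j.choose i : ℝ) * (Real.exp (K * ‖x‖) * (Real.exp (K * ‖t - x‖) *
          ‖iteratedFDeriv ℝ i ψ (t - x)‖) * L ^ (j - i)) := by ring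
      _ ≤ _ := by gcongr; exact h2
  refine key.trans (Finset.single_le_sum (f := fun j => ∑ i ∈ Finset.range (j + 1),
    (j.choose i : ℝ) * (Real.exp (K * ‖x‖) * C * L ^ (j - i))) (fun j _ => ?_)
    (Finset.mem_range.mpr (Nat.lt_succ_of_le hj)))
  exact Finset.sum_nonneg fun i _ => by positivity

/-- The test function `t ↦ conj(ψ(t - x)) e^{-2π i z · t}` of `𝒦₁(ℝⁿ)`; for real `z = ξ` it is the
complex conjugate of the time-frequency shift `M_ξ T_x ψ`. -/
def atom {n : ℕ} (ψ : K1 n) (x : RSp n) (z : CSp n) : K1 n :=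
  ⟨fun t => conj (ψ (t - x)) * cexpo z t, atom_mem ψ x z⟩

/-- The STFT `V_ψ f(x, z) = ⟨f, conj(ψ(· - x)) e^{-2π i z · ·}⟩` of `f ∈ 𝒦₁'(ℝⁿ)`,
`x ∈ ℝⁿ`, `z ∈ ℂⁿ`. -/
def stftDist {n : ℕ} (f : K1Dual n) (ψ : K1 n) (x : RSp n) (z : CSp n) : ℂ := f (atom ψ x z)

/-- The STFT `V_ψ g(x, z) = ∫ g(t) conj(ψ(t - x)) e^{-2π i z · t} dt` of a function `g` with respect
to a window function `ψ`. -/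
def stftFun {n : ℕ} (g ψ : RSp n → ℂ) (x : RSp n) (z : CSp n) : ℂ :=
  ∫ t, g t * (conj (ψ (t - x)) * cexpo z t)

/-- The `L²` inner product `(γ, ψ) = ∫ γ(t) conj(ψ(t)) dt`. -/
def ipL2 {n : ℕ} (γ ψ : RSp n → ℂ) : ℂ := ∫ t, γ t * conj (ψ t)

/-- The functional `T` on `𝒦₁(ℝⁿ) ⊗̂ 𝒰(ℂⁿ)` is given by the function `G` on `ℝⁿ × ℂⁿ`, through
`⟨T, Φ⟩ = ∬ G(x, ξ) Φ(x, ξ) dx dξ` over real `x` and `ξ`, with absolutely convergent integrals. -/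
def IsGivenBy {n : ℕ} (T : KUDual n) (G : RSp n → CSp n → ℂ) : Prop :=
  ∀ Φ : KU n,
    Integrable (fun p : RSp n × RSp n => G p.1 (cpt p.2 0) * Φ p.1 (cpt p.2 0)) volume ∧
    T Φ = ∫ p : RSp n × RSp n, G p.1 (cpt p.2 0) * Φ p.1 (cpt p.2 0)

/-- `h` is the adjoint STFT `V_ψ^* F`: for each test function `φ` the function
`conj(V_ψ(conj φ)(x, ξ))` extends to the element
`Θ(x, z) = conj(V_ψ(conj φ)(x, conj z))` of `𝒦₁(ℝⁿ) ⊗̂ 𝒰(ℂⁿ)`, and `⟨h, φ⟩ = ⟨F, Θ⟩`. -/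
def IsAdjointSTFT {n : ℕ} (F : KUDual n) (ψ : K1 n) (h : K1Dual n) : Prop :=
  ∀ φ : K1 n, ∃ Θ : KU n,
    (∀ x z, Θ x z = conj (stftFun (fun t => conj (φ t)) ψ x (conjPt z))) ∧ h φ = F Θ

/-- Hypocontinuity of a map `β : E × F → G` that is additive in each variable: for every bounded
`B ⊆ E` the maps `β(x, ·)`, `x ∈ B`, are equicontinuous, and for every bounded `B ⊆ F` the maps
`β(·, y)`, `y ∈ B`, are equicontinuous. -/
def IsHypocontinuous {E F G : Type*} [AddCommGroup E] [Module ℂ E] [TopologicalSpace E]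
    [AddCommGroup F] [Module ℂ F] [TopologicalSpace F] [AddCommGroup G] [TopologicalSpace G]
    (β : E → F → G) : Prop :=
  (∀ B : Set E, Bornology.IsVonNBounded ℂ B → ∀ W ∈ 𝓝 (0 : G), ∃ U ∈ 𝓝 (0 : F),
    ∀ x ∈ B, ∀ y ∈ U, β x y ∈ W) ∧
  (∀ B : Set F, Bornology.IsVonNBounded ℂ B → ∀ W ∈ 𝓝 (0 : G), ∃ U ∈ 𝓝 (0 : E),
    ∀ y ∈ B, ∀ x ∈ U, β x y ∈ W)

end ExpSTFT

end

open ExpSTFT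

noncomputable section

namespace ExpSTFT

/-! ### Differentiation under the integral sign and parametric derivatives -/

section Calculus

variable {P E F : Type*} [NormedAddCommGroup E] [NormedSpace ℝ E]
  [NormedAddCommGroup F] [NormedSpace ℝ F]

/-! By definition `V_ψ f(x, z)` is `f` applied to `atom ψ x z`. On a tube, where only `Re z` is
unbounded, `nu_atom_le` bounds the norms of this atom by an exponential in `|x|` times a polynomial
in `|z|`. The weights in `rho` absorb both: `Φ(x, z)` times the atom, even multiplied by a
polynomial weight with integrable reciprocal, stays bounded in `𝒦₁`, with a bound bilinear in the
norms of `Φ` and `ψ` (`weight_mul_nu_atom_le`). This gives absolute convergence, continuity and,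
once strongly bounded sets of functionals are known to be equicontinuous
(`exists_bound_of_isVonNBounded`), hypocontinuity of `V`.

For the adjoint, the element of `KU` attached to `φ` is the kernel `∫ φ(t) ψ(t - x) e^{2πi z·t} dt`.
Its `x`-derivatives, as functions of `ξ = Re z`, are inverse Fourier transforms of smooth,
exponentially decreasing functions. Derivatives in `t` become decay in `ξ`, and the two exponential
weights combine to decay in `x`, so the kernel has norms bilinear in those of `ψ` and `φ`
(`wderU_synthFun_le`). `V_ψ^* F` is then `F` composed with this map.

Inversion is first an identity of functions: integrating the kernel of `γ` and `φ` against the atoms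
of `ψ` along `Im z = η` gives `(γ, ψ) φ(t)`, by Fourier inversion in `ξ` and then integration in `x`
(`integral_scaledAtom_synth`). Since `f` commutes with the integral (`K1Dual.apply_integral`),
applying `f` gives the formula for every `η` directly, with no shift of contour; `η = 0` is the
identity for `V_γ^* V_ψ`. -/

lemma hasFTaylorSeriesUpTo_integral [MeasurableSpace P] {μ : Measure P}
    [CompleteSpace F] {g : P → E → F}
    (hg : ∀ p, ContDiff ℝ ∞ (g p))
    (hm : ∀ j t, AEStronglyMeasurable (fun p => iteratedFDeriv ℝ j (g p) t) μ)
    {b : ℕ → P → ℝ} (hb : ∀ j, Integrable (b j) μ)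
    (hgb : ∀ j p t, ‖iteratedFDeriv ℝ j (g p) t‖ ≤ b j p) :
    HasFTaylorSeriesUpTo ∞ (fun t => ∫ p, g p t ∂μ)
      (fun t j => ∫ p, iteratedFDeriv ℝ j (g p) t ∂μ) := by
  have hint : ∀ j t, Integrable (fun p => iteratedFDeriv ℝ j (g p) t) μ := fun j t =>
    (hb j).mono' (hm j t) (.of_forall fun p => hgb j p t)
  have hder : ∀ (m : ℕ) (x : E), HasFDerivAt (fun y => ∫ p, iteratedFDeriv ℝ m (g p) y ∂μ)
      (∫ p, iteratedFDeriv ℝ m.succ (g p) x ∂μ).curryLeft x := by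
    intro m x
    -- Taylor series use uncurried derivatives, `HasFDerivAt` curried ones. Currying is a linear
    -- isometry, so it passes through the integral and preserves the dominating function.
    let e : (E [×(m + 1)]→L[ℝ] F) ≃ₗᵢ[ℝ] (E →L[ℝ] E [×m]→L[ℝ] F) :=
      continuousMultilinearCurryLeftEquiv ℝ (fun _ : Fin (m + 1) => E) F
    have he : (∫ p, iteratedFDeriv ℝ m.succ (g p) x ∂μ).curryLeft =
        ∫ p, e (iteratedFDeriv ℝ (m + 1) (g p) x) ∂μ := by
      have := ContinuousLinearMap.integral_comp_comm (𝕜 := ℝ)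
        (Fₗ := E →L[ℝ] E [×m]→L[ℝ] F) e.toContinuousLinearEquiv.toContinuousLinearMap
        (hint (m + 1) x)
      exact this.symm
    rw [he]
    refine hasFDerivAt_integral_of_dominated_of_fderiv_le (bound := b (m + 1))
      (F' := fun x p => e (iteratedFDeriv ℝ (m + 1) (g p) x)) Filter.univ_mem
      (.of_forall fun y => hm m y) (hint m x)
      (e.continuous.comp_aestronglyMeasurable (hm (m + 1) x))
      (.of_forall fun p y _ => (e.norm_map _).trans_le (hgb _ _ _)) (hb (m + 1))
      (.of_forall fun p y _ => ?_)
    have h1 := ((hg p).differentiable_iteratedFDeriv (m := m) (by exact_mod_cast WithTop.coe_lt_top m)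
      y).hasFDerivAt
    convert! h1 using 1
  refine ⟨fun x => ?_, fun m _ x => hder m x, fun m _ => ?_⟩
  · have := (continuousMultilinearCurryFin0 ℝ E F).toContinuousLinearEquiv.integral_comp_comm
      (μ := μ) (fun p => iteratedFDeriv ℝ 0 (g p) x)
    refine Eq.trans this.symm ?_
    refine integral_congr_ae (.of_forall fun p => ?_)
    simp [continuousMultilinearCurryFin0_apply]
  · exact continuous_iff_continuousAt.mpr fun x => (hder m x).continuousAt

lemma contDiff_integral [MeasurableSpace P] {μ : Measure P} [CompleteSpace F] {g : P → E → F}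
    (hg : ∀ p, ContDiff ℝ ∞ (g p))
    (hm : ∀ j t, AEStronglyMeasurable (fun p => iteratedFDeriv ℝ j (g p) t) μ)
    {b : ℕ → P → ℝ} (hb : ∀ j, Integrable (b j) μ)
    (hgb : ∀ j p t, ‖iteratedFDeriv ℝ j (g p) t‖ ≤ b j p) :
    ContDiff ℝ ∞ (fun t => ∫ p, g p t ∂μ) :=
  (hasFTaylorSeriesUpTo_integral hg hm hb hgb).contDiff

lemma iteratedFDeriv_integral [MeasurableSpace P] {μ : Measure P} [CompleteSpace F] {g : P → E → F}
    (hg : ∀ p, ContDiff ℝ ∞ (g p))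
    (hm : ∀ j t, AEStronglyMeasurable (fun p => iteratedFDeriv ℝ j (g p) t) μ)
    {b : ℕ → P → ℝ} (hb : ∀ j, Integrable (b j) μ)
    (hgb : ∀ j p t, ‖iteratedFDeriv ℝ j (g p) t‖ ≤ b j p) (j : ℕ) (t : E) :
    iteratedFDeriv ℝ j (fun t => ∫ p, g p t ∂μ) t = ∫ p, iteratedFDeriv ℝ j (g p) t ∂μ :=
  ((hasFTaylorSeriesUpTo_integral hg hm hb hgb).eq_iteratedFDeriv (by exact_mod_cast le_top) t).symm

/-- The partial derivatives in the second variable of a jointly smooth function are jointly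
continuous. -/
lemma continuous_iteratedFDeriv_right [NormedAddCommGroup P] [NormedSpace ℝ P] {g : P × E → F}
    (hg : ContDiff ℝ ∞ g) (j : ℕ) :
    Continuous fun q : P × E => iteratedFDeriv ℝ j (fun t => g (q.1, t)) q.2 := by
  have h : ∀ q : P × E, iteratedFDeriv ℝ j (fun t => g (q.1, t)) q.2 =
      (iteratedFDeriv ℝ j g q).compContinuousLinearMap
        fun _ => ContinuousLinearMap.inr ℝ P E := by
    rintro ⟨p, t⟩
    -- The slice map `t ↦ (p, t)` is a linear inclusion followed by a translation, so slice
    -- derivatives are restrictions of the full derivative of `g`.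
    have h1 : (fun t => g (p, t)) =
        (fun q => g (q + (p, 0))) ∘ ContinuousLinearMap.inr ℝ P E := by
      funext s; simp
    have h2 : ContDiff ℝ ∞ (fun q => g (q + (p, (0 : E)))) :=
      hg.comp (contDiff_id.add contDiff_const)
    change iteratedFDeriv ℝ j (fun t => g (p, t)) t = _
    rw [h1, ContinuousLinearMap.iteratedFDeriv_comp_right _ h2 t
      (i := j) (by exact_mod_cast le_top), iteratedFDeriv_comp_add_right]
    simp
  simp_rw [h]
  exact (ContinuousMultilinearMap.compContinuousLinearMapL (𝕜 := ℝ) (F := F)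
    fun _ : Fin j => ContinuousLinearMap.inr ℝ P E).continuous.comp
    (hg.continuous_iteratedFDeriv (by exact_mod_cast le_top))

/-- Bound for the sums in the Leibniz rule, from uniform bounds on the two factors. -/
lemma sum_choose_mul_le {j k : ℕ} (hj : j ≤ k) {u v : ℕ → ℝ} {A B : ℝ}
    (hu0 : ∀ i, 0 ≤ u i) (hA : 0 ≤ A) (hu : ∀ i ≤ j, u i ≤ A) (hv : ∀ i ≤ j, v i ≤ B) :
    ∑ i ∈ Finset.range (j + 1), (j.choose i : ℝ) * u i * v (j - i) ≤ 2 ^ k * (A * max B 0) := by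
  calc ∑ i ∈ Finset.range (j + 1), (j.choose i : ℝ) * u i * v (j - i)
      ≤ ∑ i ∈ Finset.range (j + 1), (j.choose i : ℝ) * (A * max B 0) := by
        refine Finset.sum_le_sum fun i hi => ?_
        rw [mul_assoc]
        refine mul_le_mul_of_nonneg_left ?_ (Nat.cast_nonneg _)
        have h1 := hu i (Nat.lt_succ_iff.mp (Finset.mem_range.mp hi))
        have h2 := (hv (j - i) (Nat.sub_le _ _)).trans (le_max_left B 0)
        exact (mul_le_mul_of_nonneg_left h2 (hu0 i)).trans
          (mul_le_mul_of_nonneg_right h1 (le_max_right _ _))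
    _ = 2 ^ j * (A * max B 0) := by
        rw [← Finset.sum_mul, ← Nat.cast_sum, Nat.sum_range_choose]; norm_num
    _ ≤ _ := by
        have : 0 ≤ A * max B 0 := mul_nonneg hA (le_max_right _ _)
        gcongr
        norm_num

end Calculus

/-! ### Bounded sets and equicontinuity -/

section Bounded

open Filter

variable {E : Type*} [AddCommGroup E] [Module ℂ E] [TopologicalSpace E]
  {p : SeminormFamily ℂ E ℕ}

/-- Continuity gives a finite supremum of seminorms; for an increasing family the member of largest
index dominates it. -/
lemma exists_bound_of_continuous (hp : WithSeminorms p) (hmono : Monotone p) (f : E →L[ℂ] ℂ) :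
    ∃ (k : ℕ) (C : ℝ), 0 ≤ C ∧ ∀ x, ‖f x‖ ≤ C * p k x := by
  obtain ⟨s, C, hC, h⟩ := Seminorm.bound_of_continuous hp ((normSeminorm ℂ ℂ).comp f.toLinearMap)
    (by exact continuous_norm.comp f.continuous)
  refine ⟨s.sup id, C, C.2, fun x => (h x).trans ?_⟩
  refine mul_le_mul_of_nonneg_left ?_ C.2
  have : s.sup p ≤ p (s.sup id) := Finset.sup_le fun i hi => hmono (Finset.le_sup (f := id) hi)
  exact this x

lemma mem_nhds_of_bound (hp : WithSeminorms p) (k : ℕ) {ε : ℝ} (hε : 0 < ε) :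
    {x | p k x < ε} ∈ 𝓝 (0 : E) := by
  have := hp.mem_nhds_iff (0 : E) {x | p k x < ε}
  refine this.mpr ⟨{k}, ε, hε, fun x hx => ?_⟩
  simpa [Seminorm.mem_ball] using hx

lemma continuous_of_bound {G : Type*} [NormedAddCommGroup G] [NormedSpace ℂ G]
    (hp : WithSeminorms p) (f : E →ₗ[ℂ] G) (k : ℕ) (C : ℝ)
    (h : ∀ x, ‖f x‖ ≤ C * p k x) : Continuous f := by
  refine WithSeminorms.continuous_of_isBounded (τ₁₂ := RingHom.id ℂ) hp (norm_withSeminorms ℂ G) f ?_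
  intro _
  refine ⟨{k}, Real.toNNReal C, fun x => ?_⟩
  simp only [Finset.sup_singleton]
  refine (h x).trans ?_
  exact mul_le_mul_of_nonneg_right (Real.le_coe_toNNReal C) (apply_nonneg _ _)

/-- A strongly bounded set of continuous functionals on a space with a countable increasing family
of seminorms is equicontinuous. -/
lemma exists_bound_of_isVonNBounded [IsTopologicalAddGroup E] [ContinuousSMul ℂ E]
    (hp : WithSeminorms p) (hmono : Monotone p) {B : Set (E →L[ℂ] ℂ)}
    (hB : Bornology.IsVonNBounded ℂ B) :
    ∃ (k : ℕ) (C : ℝ), 0 ≤ C ∧ ∀ f ∈ B, ∀ x, ‖f x‖ ≤ C * p k x := by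
  by_contra! hcon
  -- Failure of the estimate with `k = C = m` is normalized by scaling `x`. When `p m x = 0`, the
  -- scaling is chosen to make the value of `f` of modulus `m` instead.
  have h1 : ∀ m : ℕ, ∃ f ∈ B, ∃ x, p m x ≤ 1 ∧ (m : ℝ) ≤ ‖f x‖ := by
    intro m
    obtain ⟨f, hf, x, hx⟩ := hcon m m (Nat.cast_nonneg m)
    rcases (apply_nonneg (p m) x).eq_or_lt with h0 | h0
    · rw [← h0, mul_zero] at hx
      refine ⟨f, hf, ((m / ‖f x‖ : ℝ) : ℂ) • x, ?_, ?_⟩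
      · rw [map_smul_eq_mul, ← h0, mul_zero]; exact zero_le_one
      · rw [map_smul, norm_smul, Complex.norm_real, Real.norm_of_nonneg (by positivity),
          div_mul_cancel₀ _ hx.ne']
    · refine ⟨f, hf, (((p m x)⁻¹ : ℝ) : ℂ) • x, ?_, ?_⟩
      · rw [map_smul_eq_mul, Complex.norm_real, Real.norm_of_nonneg (by positivity),
          inv_mul_cancel₀ h0.ne']
      · rw [map_smul, norm_smul, Complex.norm_real, Real.norm_of_nonneg (by positivity),
          inv_mul_eq_div, le_div_iff₀ h0]
        exact hx.le
  choose f hf x hx hfx using h1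
  have hbd : Bornology.IsVonNBounded ℂ (Set.range x) := by
    rw [hp.isVonNBounded_iff_seminorm_bddAbove]
    intro i
    -- For `m ≥ i` monotonicity gives `p i (x m) ≤ p m (x m) ≤ 1`; the finitely many earlier terms
    -- are covered by the sum.
    refine ⟨1 + ∑ m ∈ Finset.range i, p i (x m), ?_⟩
    rintro _ ⟨_, ⟨m, rfl⟩, rfl⟩
    rcases lt_or_ge m i with h | h
    · exact (Finset.single_le_sum (f := fun m => p i (x m)) (fun _ _ => apply_nonneg _ _)
        (Finset.mem_range.mpr h)).trans (by linarith)
    · exact ((hmono h (x m)).trans (hx m)).trans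
        (le_add_of_nonneg_right (Finset.sum_nonneg fun _ _ => apply_nonneg _ _))
  have h2 := ContinuousLinearMap.isVonNBounded_image2_apply hB hbd
  rw [NormedSpace.isVonNBounded_iff'] at h2
  obtain ⟨r, hr⟩ := h2
  obtain ⟨m, hm⟩ := exists_nat_gt r
  exact absurd (hr _ (Set.mem_image2_of_mem (hf m) ⟨m, rfl⟩)) (not_le.mpr (hm.trans_le (hfx m)))

lemma exists_bounded_of_mem_nhds [IsTopologicalAddGroup E] [ContinuousSMul ℂ E]
    {W : Set (E →L[ℂ] ℂ)} (hW : W ∈ 𝓝 0) :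
    ∃ (S : Set E) (ε : ℝ), Bornology.IsVonNBounded ℂ S ∧ 0 < ε ∧
      ∀ T : E →L[ℂ] ℂ, (∀ x ∈ S, ‖T x‖ < ε) → T ∈ W := by
  obtain ⟨⟨S, ε⟩, ⟨hS, hε⟩, h⟩ := (ContinuousLinearMap.hasBasis_nhds_zero_of_basis
    (Metric.nhds_basis_ball (x := (0 : ℂ)))).mem_iff.mp hW
  exact ⟨S, ε, hS, hε, fun T hT => h fun x hx => by simpa using hT x hx⟩

lemma mem_nhds_of_isVonNBounded [IsTopologicalAddGroup E] [ContinuousSMul ℂ E]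
    {S : Set E} (hS : Bornology.IsVonNBounded ℂ S) {ε : ℝ} (hε : 0 < ε) :
    {T : E →L[ℂ] ℂ | ∀ x ∈ S, ‖T x‖ < ε} ∈ 𝓝 (0 : E →L[ℂ] ℂ) := by
  filter_upwards [ContinuousLinearMap.eventually_nhds_zero_mapsTo hS (Metric.ball_mem_nhds (0 : ℂ) hε)]
    with T hT x hx
  simpa using hT hx

end Bounded

variable {n : ℕ}

/-! ### The norms of `𝒦₁(ℝⁿ)` and `𝒦₁(ℝⁿ) ⊗̂ 𝒰(ℂⁿ)` -/

namespace K1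

@[ext] lemma ext {φ χ : K1 n} (h : ∀ t, φ t = χ t) : φ = χ := DFunLike.ext _ _ h

lemma contDiff (φ : K1 n) : ContDiff ℝ ∞ φ := φ.2.1

lemma continuous (φ : K1 n) : Continuous φ := φ.contDiff.continuous

@[simp] lemma add_apply (φ χ : K1 n) (t : RSp n) : (φ + χ) t = φ t + χ t := rfl

@[simp] lemma smul_apply (c : ℂ) (φ : K1 n) (t : RSp n) : (c • φ) t = c * φ t := rfl

lemma wder_le_nu (φ : K1 n) {j k : ℕ} (hj : j ≤ k) (t : RSp n) : wder k φ j t ≤ nu n k φ :=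
  le_ciSup (φ.bdd k) (⟨j, Nat.lt_succ_of_le hj⟩, t)

lemma nu_le {φ : K1 n} {k : ℕ} {C : ℝ} (h : ∀ j ≤ k, ∀ t, wder k φ j t ≤ C) : nu n k φ ≤ C :=
  ciSup_le fun p => h p.1 (Nat.lt_succ_iff.mp p.1.2) p.2

lemma norm_iteratedFDeriv_le (φ : K1 n) {j k : ℕ} (hj : j ≤ k) (t : RSp n) :
    ‖iteratedFDeriv ℝ j φ t‖ ≤ nu n k φ * Real.exp (-(k * ‖t‖)) := by
  rw [Real.exp_neg, ← div_eq_mul_inv, le_div_iff₀ (Real.exp_pos _), mul_comm]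
  exact φ.wder_le_nu hj t

lemma norm_le (φ : K1 n) (k : ℕ) (t : RSp n) : ‖φ t‖ ≤ nu n k φ * Real.exp (-(k * ‖t‖)) := by
  simpa using φ.norm_iteratedFDeriv_le (Nat.zero_le k) t

lemma wder_mono {φ : RSp n → ℂ} {k l : ℕ} (h : k ≤ l) (j : ℕ) (t : RSp n) :
    wder k φ j t ≤ wder l φ j t := by
  unfold wder
  gcongr

lemma nu_mono : Monotone (nuFamily n) := fun _ _ h φ =>
  nu_le fun j hj t => (wder_mono h j t).trans (φ.wder_le_nu (hj.trans h) t)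

end K1

namespace KU

@[ext] lemma ext {Φ Ψ : KU n} (h : ∀ x z, Φ x z = Ψ x z) : Φ = Ψ :=
  DFunLike.ext _ _ fun x => funext (h x)

@[simp] lemma add_apply (Φ Ψ : KU n) (x : RSp n) (z : CSp n) : (Φ + Ψ) x z = Φ x z + Ψ x z := rfl

@[simp] lemma smul_apply (c : ℂ) (Φ : KU n) (x : RSp n) (z : CSp n) :
    (c • Φ) x z = c * Φ x z := rfl

lemma wderU_le_rho (Φ : KU n) {j k : ℕ} (hj : j ≤ k) (x : RSp n) {z : CSp n}
    (hz : z ∈ tube n k) : wderU k Φ j x z ≤ rho n k Φ :=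
  le_ciSup (Φ.bdd k) (⟨j, Nat.lt_succ_of_le hj⟩, x, ⟨z, hz⟩)

lemma rho_le {Φ : KU n} {k : ℕ} {C : ℝ}
    (h : ∀ j ≤ k, ∀ x, ∀ z ∈ tube n k, wderU k Φ j x z ≤ C) : rho n k Φ ≤ C :=
  ciSup_le fun p => h p.1 (Nat.lt_succ_iff.mp p.1.2) p.2.1 p.2.2 p.2.2.2

lemma tube_mono {k l : ℕ} (h : k ≤ l) : tube n k ⊆ tube n l := fun _ hz i =>
  (hz i).trans (by exact_mod_cast h)

lemma rho_mono : Monotone (rhoFamily n) := fun k l h Φ => by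
  refine rho_le fun j hj x z hz => le_trans ?_ (Φ.wderU_le_rho (hj.trans h) x (tube_mono h hz))
  unfold wderU
  refine mul_le_mul ?_ (K1.wder_mono h j x) (by unfold wder; positivity) (by positivity)
  refine Real.rpow_le_rpow_of_exponent_le (by nlinarith [norm_nonneg z]) ?_
  gcongr

end KU

/-! ### Exponentials and atoms -/

/-- The integer `7` stands in for `2π`, so that all losses of exponential weight are natural numbers
and can be added to the order of a norm. -/
lemma norm_expoForm_le (z : CSp n) : ‖expoForm z‖ ≤ 7 * n * ‖z‖ := by
  have hpi : 2 * Real.pi ≤ 7 := by linarith [Real.pi_lt_d2]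
  refine ContinuousLinearMap.opNorm_le_bound _ (by positivity) fun t => ?_
  simp only [expoForm, _root_.sum_apply, ContinuousLinearMap.smulRight_apply]
  calc _ ≤ ∑ _i : Fin n, 7 * ‖z‖ * ‖t‖ := by
        refine norm_sum_le_of_le _ fun i _ => ?_
        rw [norm_smul]
        have h1 : ‖(EuclideanSpace.proj i : RSp n →L[ℝ] ℝ) t‖ ≤ ‖t‖ := PiLp.norm_apply_le t i
        have h2 : ‖-2 * (Real.pi : ℂ) * Complex.I * z i‖ ≤ 7 * ‖z‖ := by
          simp only [norm_mul, norm_neg, Complex.norm_ofNat, Complex.norm_real, Complex.norm_I,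
            mul_one, Real.norm_of_nonneg Real.pi_pos.le]
          exact mul_le_mul hpi (PiLp.norm_apply_le z i) (norm_nonneg _) (by norm_num)
        rw [mul_comm (7 * ‖z‖)]
        exact mul_le_mul h1 h2 (norm_nonneg _) (norm_nonneg _)
    _ = _ := by simp; ring

/-- The modulus sees only `Im z`, whose coordinates are at most `m` on the tube; the growth rate in
`t` is therefore uniform in `Re z`. -/
lemma norm_cexpo_le {m : ℕ} {z : CSp n} (hz : z ∈ tube n m) (t : RSp n) :
    ‖cexpo z t‖ ≤ Real.exp ((7 * n * m : ℕ) * ‖t‖) := by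
  have hpi : 2 * Real.pi ≤ 7 := by linarith [Real.pi_lt_d2]
  rw [cexpo, Complex.norm_exp]
  refine Real.exp_le_exp.mpr ?_
  have h0 : (-2 * (Real.pi : ℂ) * Complex.I * cdot z t).re = 2 * Real.pi * (cdot z t).im := by
    simp [Complex.mul_re, Complex.mul_im]
  have h1 : (cdot z t).im ≤ n * (m * ‖t‖) := by
    simp only [cdot, Complex.im_sum]
    calc _ ≤ ∑ _i : Fin n, (m * ‖t‖) := by
          refine Finset.sum_le_sum fun i _ => ?_
          have : (z i * (t i : ℂ)).im = (z i).im * t i := by simp [Complex.mul_im]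
          rw [this]
          refine (le_abs_self _).trans ?_
          rw [abs_mul]
          exact mul_le_mul (hz i) (PiLp.norm_apply_le t i) (abs_nonneg _) (Nat.cast_nonneg _)
      _ = _ := by simp
  rw [h0]
  push_cast
  calc _ ≤ 2 * Real.pi * (n * (m * ‖t‖)) := by gcongr
    _ ≤ 7 * (n * (m * ‖t‖)) := by gcongr
    _ = _ := by ring

/-- Each derivative multiplies by `expoForm z` and leaves the exponential intact. Unlike
`norm_iteratedFDeriv_cexpo`, this keeps `Re z` out of the exponent, so it contributes only
polynomial growth. -/
lemma norm_iteratedFDeriv_cexpo_le (z : CSp n) (j : ℕ) (t : RSp n) :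
    ‖iteratedFDeriv ℝ j (cexpo z) t‖ ≤ ‖expoForm z‖ ^ j * ‖cexpo z t‖ := by
  induction j with
  | zero => simp
  | succ j ih =>
    have hd : fderiv ℝ (cexpo z) =
        (ContinuousLinearMap.toSpanSingleton ℂ (expoForm z)).restrictScalars ℝ ∘ cexpo z := by
      funext s
      rw [cexpo_eq]
      simpa using ((expoForm z).hasFDerivAt (x := s)).cexp.fderiv
    rw [← norm_iteratedFDeriv_fderiv, hd]
    refine (ContinuousLinearMap.norm_iteratedFDeriv_comp_left _ (N := ∞)
      (contDiff_cexpo z).contDiffAt (by exact_mod_cast le_top)).trans ?_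
    rw [ContinuousLinearMap.norm_restrictScalars, ContinuousLinearMap.norm_toSpanSingleton,
      pow_succ', mul_assoc]
    exact mul_le_mul_of_nonneg_left ih (norm_nonneg _)

lemma norm_iteratedFDeriv_cexpo_le_pow {m j k : ℕ} (hj : j ≤ k) {z : CSp n} (hz : z ∈ tube n m)
    (t : RSp n) : ‖iteratedFDeriv ℝ j (cexpo z) t‖ ≤
      (7 * n + 1) ^ k * (1 + ‖z‖) ^ k * Real.exp ((7 * n * m : ℕ) * ‖t‖) := by
  refine (norm_iteratedFDeriv_cexpo_le z j t).trans ?_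
  refine mul_le_mul ?_ (norm_cexpo_le hz t) (norm_nonneg _) (by positivity)
  have h0 := norm_nonneg z
  have h1 : (1 : ℝ) ≤ (7 * n + 1) * (1 + ‖z‖) := by
    have : (0 : ℝ) ≤ n := Nat.cast_nonneg n
    nlinarith [mul_nonneg this h0]
  calc ‖expoForm z‖ ^ j ≤ ((7 * n + 1) * (1 + ‖z‖)) ^ j := by
        refine pow_le_pow_left₀ (norm_nonneg _) ((norm_expoForm_le z).trans ?_) _
        have : (0 : ℝ) ≤ n := Nat.cast_nonneg n
        nlinarith
    _ ≤ ((7 * n + 1) * (1 + ‖z‖)) ^ k := pow_le_pow_right₀ h1 hj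
    _ = _ := mul_pow _ _ _

/-- Multiplication by an exponential costs polynomial growth in `z` and a fixed exponential
growth in `t`. -/
lemma wder_mul_cexpo_le {h : RSp n → ℂ} (hh : ContDiff ℝ ∞ h) {k m : ℕ} {z : CSp n}
    (hz : z ∈ tube n m) {A : ℝ} (hA : 0 ≤ A)
    (hb : ∀ i ≤ k, ∀ t, ‖iteratedFDeriv ℝ i h t‖ ≤ A * Real.exp (-((k + 7 * n * m : ℕ) * ‖t‖)))
    {j : ℕ} (hj : j ≤ k) (t : RSp n) :
    wder k (fun t => h t * cexpo z t) j t ≤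
      2 ^ k * (A * ((7 * n + 1) ^ k * (1 + ‖z‖) ^ k)) := by
  unfold wder
  refine (mul_le_mul_of_nonneg_left ((norm_iteratedFDeriv_mul_le hh (contDiff_cexpo z) t
      (by exact_mod_cast le_top)).trans (sum_choose_mul_le hj (fun i => norm_nonneg _)
      (by positivity) (fun i hi => hb i (hi.trans hj) t)
      fun i hi => norm_iteratedFDeriv_cexpo_le_pow (hi.trans hj) hz t)) (Real.exp_pos _).le).trans ?_
  rw [max_eq_left (by positivity)]
  refine le_of_eq ?_
  -- The `7 * n * m` extra orders of decay exactly pay for the growth of the exponential on the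
  -- tube.
  have : Real.exp (k * ‖t‖) * Real.exp (-((k + 7 * n * m : ℕ) * ‖t‖)) *
      Real.exp ((7 * n * m : ℕ) * ‖t‖) = 1 := by
    rw [← Real.exp_add, ← Real.exp_add, Real.exp_eq_one_iff]
    push_cast
    ring
  linear_combination (2 ^ k * (A * ((7 * n + 1) ^ k * (1 + ‖z‖) ^ k))) * this

lemma exp_neg_norm_sub_le (k : ℕ) (x t : RSp n) :
    Real.exp (-(k * ‖t - x‖)) ≤ Real.exp (k * ‖x‖) * Real.exp (-(k * ‖t‖)) := by
  rw [← Real.exp_add]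
  refine Real.exp_le_exp.mpr ?_
  have h : ‖t‖ ≤ ‖t - x‖ + ‖x‖ := by simpa using norm_add_le (t - x) x
  nlinarith [mul_le_mul_of_nonneg_left h (Nat.cast_nonneg k : (0 : ℝ) ≤ k)]

lemma norm_iteratedFDeriv_conj (φ : RSp n → ℂ) (j : ℕ) (t : RSp n) :
    ‖iteratedFDeriv ℝ j (fun t => conj (φ t)) t‖ = ‖iteratedFDeriv ℝ j φ t‖ :=
  Complex.conjLIE.norm_iteratedFDeriv_comp_left (𝕜 := ℝ) φ t j

lemma contDiff_conj {E : Type*} [NormedAddCommGroup E] [NormedSpace ℝ E] {φ : E → ℂ}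
    (h : ContDiff ℝ ∞ φ) : ContDiff ℝ ∞ fun t => conj (φ t) := Complex.conjCLE.contDiff.comp h

lemma nu_atom_le (ψ : K1 n) (x : RSp n) {k m : ℕ} {z : CSp n} (hz : z ∈ tube n m) :
    K1.nu n k (atom ψ x z) ≤ 2 ^ k * ((Real.exp ((k + 7 * n * m : ℕ) * ‖x‖) *
      K1.nu n (k + 7 * n * m) ψ) * ((7 * n + 1) ^ k * (1 + ‖z‖) ^ k)) := by
  have hs : ContDiff ℝ ∞ (fun t => conj (ψ (t - x))) :=
    contDiff_conj (ψ.contDiff.comp (contDiff_id.sub contDiff_const))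
  have h0 : 0 ≤ K1.nu n (k + 7 * n * m) ψ := apply_nonneg _ _
  refine K1.nu_le fun j hj t => wder_mul_cexpo_le hs hz (by positivity) (fun i hi s => ?_) hj t
  rw [norm_iteratedFDeriv_conj, iteratedFDeriv_comp_sub, mul_assoc, mul_left_comm]
  exact (ψ.norm_iteratedFDeriv_le (by omega) (s - x)).trans
    (mul_le_mul_of_nonneg_left (exp_neg_norm_sub_le _ _ _) h0)

/-- A jointly smooth family of test functions that is locally bounded in `𝒦₁(ℝⁿ)` is continuous
in `𝒦₁(ℝⁿ)`. -/
lemma K1.continuous_of_contDiff {P : Type*} [NormedAddCommGroup P] [NormedSpace ℝ P] {a : P → K1 n}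
    (ha : ContDiff ℝ ∞ fun q : P × RSp n => a q.1 q.2)
    (hb : ∀ p₀ k, ∃ C : ℝ, ∀ᶠ p in 𝓝 p₀, K1.nu n k (a p) ≤ C) : Continuous a := by
  rw [continuous_iff_continuousAt]
  intro p₀
  refine ((K1.withSeminorms n).tendsto_nhds _ _).mpr fun k ε hε => ?_
  -- One order beyond `k` leaves a spare factor `e^{-|t|}`, which makes the weighted derivatives
  -- small outside a ball, uniformly for `p` near `p₀`. Inside the ball, compactness and joint
  -- continuity suffice.
  obtain ⟨C, hC⟩ := hb p₀ (k + 1)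
  have hC0 := hC.self_of_nhds
  obtain ⟨R, hR⟩ : ∃ R : ℝ, ∀ r ≥ R, (C + C) * Real.exp (-r) ≤ ε / 2 := by
    have h1 : Filter.Tendsto (fun r => (C + C) * Real.exp (-r)) Filter.atTop (𝓝 ((C + C) * 0)) :=
      (Real.tendsto_exp_neg_atTop_nhds_zero).const_mul _
    rw [mul_zero] at h1
    exact Filter.eventually_atTop.mp (h1.eventually_le_const (half_pos hε))
  have hnear : ∀ᶠ p in 𝓝 p₀, ∀ j : Fin (k + 1), ∀ t ∈ Metric.closedBall (0 : RSp n) R,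
      Real.exp (k * ‖t‖) * ‖iteratedFDeriv ℝ j (a p) t - iteratedFDeriv ℝ j (a p₀) t‖ < ε / 2 := by
    refine Filter.eventually_all.mpr fun j => ?_
    refine (isCompact_closedBall (0 : RSp n) R).eventually_forall_of_forall_eventually
      fun t _ => ?_
    have hcont : Continuous fun q : P × RSp n => Real.exp (k * ‖q.2‖) *
        ‖iteratedFDeriv ℝ j (a q.1) q.2 - iteratedFDeriv ℝ j (a p₀) q.2‖ := by
      have h1 := continuous_iteratedFDeriv_right ha j
      have h2 := (a p₀).contDiff.continuous_iteratedFDeriv (m := j) (by exact_mod_cast le_top)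
      have h3 := h1.sub (h2.comp continuous_snd)
      exact (by fun_prop : Continuous fun q : P × RSp n => Real.exp (k * ‖q.2‖)).mul h3.norm
    refine hcont.continuousAt.eventually_lt continuousAt_const ?_
    simpa using half_pos hε
  filter_upwards [hC, hnear] with p hp hpn
  refine lt_of_le_of_lt (K1.nu_le fun j hj t => ?_) (half_lt_self hε)
  have hsub : iteratedFDeriv ℝ j ((a p - a p₀ : K1 n) : RSp n → ℂ) t =
      iteratedFDeriv ℝ j (a p) t - iteratedFDeriv ℝ j (a p₀) t :=
    iteratedFDeriv_sub_apply ((a p).contDiff.of_le (by exact_mod_cast le_top)).contDiffAt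
      ((a p₀).contDiff.of_le (by exact_mod_cast le_top)).contDiffAt
  unfold wder
  rw [hsub]
  rcases le_total ‖t‖ R with h | h
  · exact (hpn ⟨j, Nat.lt_succ_of_le hj⟩ t (by simpa using h)).le
  · refine le_trans ?_ (hR _ h)
    have h1 := (a p).norm_iteratedFDeriv_le (hj.trans (Nat.le_succ k)) t
    have h2 := (a p₀).norm_iteratedFDeriv_le (hj.trans (Nat.le_succ k)) t
    have h3 : Real.exp (k * ‖t‖) * Real.exp (-((k + 1 : ℕ) * ‖t‖)) = Real.exp (-‖t‖) := by
      rw [← Real.exp_add]; congr 1; push_cast; ring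
    calc _ ≤ Real.exp (k * ‖t‖) * (C * Real.exp (-((k + 1 : ℕ) * ‖t‖)) +
          C * Real.exp (-((k + 1 : ℕ) * ‖t‖))) := by
          refine mul_le_mul_of_nonneg_left ((norm_sub_le _ _).trans (add_le_add ?_ ?_))
            (Real.exp_pos _).le
          · exact h1.trans (mul_le_mul_of_nonneg_right hp (Real.exp_pos _).le)
          · exact h2.trans (mul_le_mul_of_nonneg_right hC0 (Real.exp_pos _).le)
      _ = _ := by rw [← h3]; ring

lemma exists_cpt_mem_tube (η : RSp n) : ∃ m : ℕ, ∀ ξ : RSp n, cpt ξ η ∈ tube n m := by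
  obtain ⟨m, hm⟩ := exists_nat_ge ‖η‖
  refine ⟨m, fun ξ i => ?_⟩
  have : (cpt ξ η i).im = η i := by simp [cpt]
  rw [this]
  exact (PiLp.norm_apply_le η i).trans hm

lemma continuous_cpt (η : RSp n) : Continuous fun ξ : RSp n => cpt ξ η := by
  unfold cpt
  fun_prop

lemma contDiff_cexpo_cpt {X : Type*} [NormedAddCommGroup X] [NormedSpace ℝ X] {u v : X → RSp n}
    (hu : ContDiff ℝ ∞ u) (hv : ContDiff ℝ ∞ v) (η : RSp n) :
    ContDiff ℝ ∞ fun q => cexpo (cpt (u q) η) (v q) := by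
  have hc : ∀ {w : X → RSp n}, ContDiff ℝ ∞ w → ∀ i, ContDiff ℝ ∞ fun q => (w q i : ℂ) :=
    fun hw i => Complex.ofRealCLM.contDiff.comp
      ((EuclideanSpace.proj i : RSp n →L[ℝ] ℝ).contDiff.comp hw)
  unfold cexpo cdot
  exact Complex.contDiff_exp.comp (contDiff_const.mul (ContDiff.sum fun i _ =>
    ((hc hu i).add contDiff_const).mul (hc hv i)))

lemma continuous_atom (ψ : K1 n) (η : RSp n) :
    Continuous fun p : RSp n × RSp n => atom ψ p.1 (cpt p.2 η) := by
  refine K1.continuous_of_contDiff ?_ fun p₀ k => ?_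
  · have h1 : ContDiff ℝ ∞ fun q : (RSp n × RSp n) × RSp n => ψ (q.2 - q.1.1) :=
      ψ.contDiff.comp (contDiff_snd.sub contDiff_fst.fst)
    have h2 : ContDiff ℝ ∞ fun q : (RSp n × RSp n) × RSp n => cexpo (cpt q.1.2 η) q.2 :=
      contDiff_cexpo_cpt contDiff_fst.snd contDiff_snd η
    exact (contDiff_conj h1).mul h2
  · obtain ⟨m, hm⟩ := exists_cpt_mem_tube η
    have hc : Continuous fun p : RSp n × RSp n =>
        2 ^ k * ((Real.exp ((k + 7 * n * m : ℕ) * ‖p.1‖) *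
      K1.nu n (k + 7 * n * m) ψ) * ((7 * n + 1) ^ k * (1 + ‖cpt p.2 η‖) ^ k)) := by
      have := (continuous_cpt η).comp (continuous_snd (X := RSp n))
      fun_prop
    refine ⟨_, (hc.continuousAt.eventually_le_const (lt_add_one _)).mono
      fun p hp => (nu_atom_le ψ p.1 (hm p.2)).trans hp⟩

/-! ### Functionals commute with integrals in `𝒦₁(ℝⁿ)` -/

/-- The Banach space of jets of order `k` at a point of `ℝⁿ`. -/
def JetFiber (n k : ℕ) : Type := ∀ j : Fin (k + 1), (RSp n) [×(j : ℕ)]→L[ℝ] ℂ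

instance (n k : ℕ) : NormedAddCommGroup (JetFiber n k) :=
  inferInstanceAs (NormedAddCommGroup (∀ j : Fin (k + 1), (RSp n) [×(j : ℕ)]→L[ℝ] ℂ))

instance (n k : ℕ) : NormedSpace ℂ (JetFiber n k) :=
  inferInstanceAs (NormedSpace ℂ (∀ j : Fin (k + 1), (RSp n) [×(j : ℕ)]→L[ℝ] ℂ))

instance (n k : ℕ) : CompleteSpace (JetFiber n k) :=
  inferInstanceAs (CompleteSpace (∀ j : Fin (k + 1), (RSp n) [×(j : ℕ)]→L[ℝ] ℂ))

/-- The component of order `j` of a jet. -/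
def JetFiber.component {n k : ℕ} (j : Fin (k + 1)) :
    JetFiber n k →L[ℂ] (RSp n) [×(j : ℕ)]→L[ℝ] ℂ :=
  ContinuousLinearMap.proj (R := ℂ) (φ := fun j : Fin (k + 1) => (RSp n) [×(j : ℕ)]→L[ℝ] ℂ) j

/-- The Banach space in which the weighted jets of test functions live. -/
abbrev JetSpace (n k : ℕ) : Type := BoundedContinuousFunction (RSp n) (JetFiber n k)

/-- The weighted jet `(e^{k|t|} φ^{(j)}(t))_{j ≤ k}` of a function at a point. -/
def jetAt (k : ℕ) (φ : RSp n → ℂ) (t : RSp n) : JetFiber n k :=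
  fun j => Real.exp (k * ‖t‖) • iteratedFDeriv ℝ (j : ℕ) φ t

lemma norm_jet_le (k : ℕ) (φ : K1 n) (t : RSp n) :
    ‖jetAt k φ t‖ ≤ K1.nu n k φ := by
  refine (pi_norm_le_iff_of_nonneg (apply_nonneg _ _)).mpr fun j => ?_
  refine (norm_smul (Real.exp (k * ‖t‖)) (iteratedFDeriv ℝ (j : ℕ) φ t)).trans_le ?_
  rw [Real.norm_of_nonneg (Real.exp_pos _).le]
  exact φ.wder_le_nu (Nat.lt_succ_iff.mp j.2) t

/-- The weighted jet `(e^{k|t|} φ^{(j)}(t))_{j ≤ k}` of a test function. -/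
def jet (n k : ℕ) : K1 n →ₗ[ℂ] JetSpace n k where
  toFun φ := BoundedContinuousFunction.ofNormedAddCommGroup
    (jetAt k φ) (continuous_pi fun j => (by fun_prop : Continuous fun t : RSp n => Real.exp (k * ‖t‖)).smul
      (φ.contDiff.continuous_iteratedFDeriv (by exact_mod_cast le_top)))
    (K1.nu n k φ) (norm_jet_le k φ)
  map_add' φ χ := by
    refine BoundedContinuousFunction.ext fun t => funext fun j => ?_
    have h : iteratedFDeriv ℝ (j : ℕ) ((φ + χ : K1 n) : RSp n → ℂ) t = _ :=
      iteratedFDeriv_add_apply (φ.contDiff.of_le (by exact_mod_cast le_top)).contDiffAt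
        (χ.contDiff.of_le (by exact_mod_cast le_top)).contDiffAt
    exact (congrArg _ h).trans (smul_add _ _ _)
  map_smul' c φ := by
    refine BoundedContinuousFunction.ext fun t => funext fun j => ?_
    have h : iteratedFDeriv ℝ (j : ℕ) ((c • φ : K1 n) : RSp n → ℂ) t = _ :=
      iteratedFDeriv_const_smul_apply (φ.contDiff.of_le (by exact_mod_cast le_top)).contDiffAt
    exact (congrArg _ h).trans (smul_comm _ _ _)

lemma jet_apply (k : ℕ) (φ : K1 n) (t : RSp n) (j : Fin (k + 1)) :
    jet n k φ t j = Real.exp (k * ‖t‖) • iteratedFDeriv ℝ (j : ℕ) φ t := rfl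

lemma norm_jet (k : ℕ) (φ : K1 n) : ‖jet n k φ‖ = K1.nu n k φ := by
  refine le_antisymm
    (BoundedContinuousFunction.norm_ofNormedAddCommGroup_le _ (apply_nonneg _ _)
      (norm_jet_le k φ))
    (K1.nu_le fun j hj t => ?_)
  have h1 := (norm_le_pi_norm (G := fun j : Fin (k + 1) => (RSp n) [×(j : ℕ)]→L[ℝ] ℂ)
    (jetAt k φ t) ⟨j, Nat.lt_succ_of_le hj⟩).trans
    ((jet n k φ).norm_coe_le_norm t)
  have h2 := norm_smul (Real.exp (k * ‖t‖)) (iteratedFDeriv ℝ j φ t)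
  rw [Real.norm_of_nonneg (Real.exp_pos _).le] at h2
  exact h2.symm.trans_le h1

lemma jet_injective (n k : ℕ) : Function.Injective (jet n k) := by
  refine (injective_iff_map_eq_zero _).mpr fun φ h => K1.ext fun t => ?_
  have h1 := φ.norm_le k t
  rw [← norm_jet, h, norm_zero, zero_mul] at h1
  exact norm_le_zero_iff.mp h1

lemma continuous_jet (n k : ℕ) : Continuous (jet n k) :=
  continuous_of_bound (K1.withSeminorms n) (jet n k) k 1 fun φ => by
    rw [norm_jet, one_mul]; rfl

/-- A functional bounded by `nu n k` is bounded on the range of the norm-preserving map `jet n k`,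
and Hahn–Banach extends it to the whole Banach space. Bochner integration thus becomes available for
functionals on a space that is only Fréchet. -/
lemma exists_factor_jet (f : K1Dual n) :
    ∃ (k : ℕ) (G : JetSpace n k →L[ℂ] ℂ), ∀ φ, f φ = G (jet n k φ) := by
  obtain ⟨k, C, -, hf⟩ := exists_bound_of_continuous (K1.withSeminorms n) K1.nu_mono f
  let e := LinearEquiv.ofInjective (jet n k) (jet_injective n k)
  let g : LinearMap.range (jet n k) →L[ℂ] ℂ :=
    (f.toLinearMap ∘ₗ e.symm.toLinearMap).mkContinuous C fun y => by
      obtain ⟨φ, rfl⟩ := e.surjective y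
      simp only [LinearMap.comp_apply, LinearEquiv.coe_coe, LinearEquiv.symm_apply_apply]
      refine (hf φ).trans_eq ?_
      have : ‖e φ‖ = K1.nu n k φ := norm_jet k φ
      rw [this]; rfl
  obtain ⟨G, hG, -⟩ := exists_extension_norm_eq _ g
  refine ⟨k, G, fun φ => ?_⟩
  have h1 := hG (e φ)
  have h2 : g (e φ) = f φ := by
    change f (e.symm (e φ)) = f φ
    rw [e.symm_apply_apply]
  exact h2.symm.trans h1.symm

section Integral

variable {P : Type*} [MeasurableSpace P] [TopologicalSpace P] [OpensMeasurableSpace P]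
  {μ : Measure P} {a : P → K1 n} {b : ℕ → P → ℝ}

lemma K1Dual.integrable_comp (ha : Continuous a) (hb : ∀ k, Integrable (b k) μ)
    (hab : ∀ k p, K1.nu n k (a p) ≤ b k p) (f : K1Dual n) : Integrable (fun p => f (a p)) μ := by
  obtain ⟨k, C, hC, hf⟩ := exists_bound_of_continuous (K1.withSeminorms n) K1.nu_mono f
  exact ((hb k).const_mul C).mono' (f.continuous.comp ha).aestronglyMeasurable
    (.of_forall fun p => (hf _).trans (mul_le_mul_of_nonneg_left (hab k p) hC))

/-- `f` factors through weighted jets, where the Bochner integral exists and commutes with `G`. It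
remains to see that this integral is the jet of the pointwise integral `g`, which is differentiation
under the integral sign tested at each point and order. -/
lemma K1Dual.apply_integral [SecondCountableTopology P] (ha : Continuous a) (hb : ∀ k, Integrable (b k) μ)
    (hab : ∀ k p, K1.nu n k (a p) ≤ b k p) {g : K1 n} (hg : ∀ t, g t = ∫ p, a p t ∂μ)
    (f : K1Dual n) : f g = ∫ p, f (a p) ∂μ := by
  obtain ⟨k, G, hG⟩ := exists_factor_jet f
  have hint : ∀ k, Integrable (fun p => jet n k (a p)) μ := fun k =>
    (hb k).mono' ((continuous_jet n k).comp ha).aestronglyMeasurable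
      (.of_forall fun p => (norm_jet k (a p)).trans_le (hab k p))
  have hev : ∀ k t (j : Fin (k + 1)), (∫ p, jet n k (a p) ∂μ) t j =
      ∫ p, Real.exp (k * ‖t‖) • iteratedFDeriv ℝ (j : ℕ) (a p) t ∂μ ∧
      Integrable (fun p => Real.exp (k * ‖t‖) • iteratedFDeriv ℝ (j : ℕ) (a p) t) μ := by
    intro k t j
    let L : JetSpace n k →L[ℝ] (RSp n) [×(j : ℕ)]→L[ℝ] ℂ :=
      ((JetFiber.component j).comp (BoundedContinuousFunction.evalCLM ℂ t)).restrictScalars ℝ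
    exact ⟨(L.integral_comp_comm (hint k)).symm, L.integrable_comp (hint k)⟩
  -- Component `j` of the jet of order `j` is measurable; dividing by its positive weight recovers
  -- the bare derivative.
  have hmeas : ∀ j t, AEStronglyMeasurable (fun p => iteratedFDeriv ℝ j (a p) t) μ := by
    intro j t
    have h := (hev j t ⟨j, Nat.lt_succ_self j⟩).2.aestronglyMeasurable.const_smul
      (Real.exp (j * ‖t‖))⁻¹
    refine h.congr (.of_forall fun p => ?_)
    simp only [Pi.smul_apply]
    exact inv_smul_smul₀ (Real.exp_pos _).ne' _
  have hjet : jet n k g = ∫ p, jet n k (a p) ∂μ := by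
    refine BoundedContinuousFunction.ext fun t => funext fun j => ?_
    rw [(hev k t j).1, integral_smul, jet_apply]
    have hg' : (g : RSp n → ℂ) = fun t => ∫ p, a p t ∂μ := funext hg
    rw [hg', iteratedFDeriv_integral (fun p => (a p).contDiff) hmeas hb]
    intro j p t
    refine ((a p).norm_iteratedFDeriv_le le_rfl t).trans (le_trans ?_ (hab j p))
    exact mul_le_of_le_one_right (apply_nonneg _ _) (Real.exp_le_one_iff.mpr (by
      have := norm_nonneg t
      have : (0 : ℝ) ≤ j * ‖t‖ := by positivity
      linarith))
  rw [hG, hjet, ← G.integral_comp_comm (hint k)]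
  exact integral_congr_ae (.of_forall fun p => (hG (a p)).symm)

end Integral

/-! ### Weighted estimates for the integrand `V_ψ f · Φ` -/

/-- A polynomial weight on `ℝⁿ × ℝⁿ` with integrable reciprocal. -/
def weight (p : RSp n × RSp n) : ℝ := (1 + ‖p.1‖) ^ (n + 1) * (1 + ‖p.2‖) ^ (n + 1)

lemma weight_pos (p : RSp n × RSp n) : 0 < weight p := by unfold weight; positivity

/-- A polynomially decreasing integrable function on `ℝⁿ`. -/
def decay (t : RSp n) : ℝ := ((1 + ‖t‖) ^ (n + 1))⁻¹

lemma decay_nonneg (t : RSp n) : 0 ≤ decay t := by unfold decay; positivity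

lemma integrable_decay : Integrable (decay : RSp n → ℝ) := by
  have h1 := integrable_one_add_norm (E := RSp n) (μ := volume) (r := (n + 1 : ℕ)) (by simp)
  refine h1.congr (.of_forall fun x => ?_)
  simp only [decay]
  rw [Real.rpow_neg (by positivity), Real.rpow_natCast]

lemma integrable_inv_weight : Integrable (fun p : RSp n × RSp n => (weight p)⁻¹) := by
  refine (integrable_decay.mul_prod integrable_decay).congr (.of_forall fun p => ?_)
  simp only [weight, mul_inv, decay]

lemma one_add_sq_rpow_eq (a : ℝ) (k : ℕ) :
    (1 + a ^ 2) ^ ((k : ℝ) / 2) = Real.sqrt (1 + a ^ 2) ^ k := by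
  rw [Real.sqrt_eq_rpow, ← Real.rpow_natCast (_ ^ (1 / 2 : ℝ)), ← Real.rpow_mul (by positivity)]
  congr 1
  ring

lemma one_add_pow_le {a : ℝ} (ha : 0 ≤ a) (k : ℕ) :
    (1 + a) ^ k ≤ 2 ^ k * (1 + a ^ 2) ^ ((k : ℝ) / 2) := by
  rw [one_add_sq_rpow_eq, ← mul_pow]
  refine pow_le_pow_left₀ (by positivity) ?_ k
  have h1 : 1 ≤ Real.sqrt (1 + a ^ 2) := Real.one_le_sqrt.mpr (by nlinarith)
  have h2 : a ≤ Real.sqrt (1 + a ^ 2) := Real.le_sqrt_of_sq_le (by linarith)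
  linarith

lemma one_add_sq_rpow_le {a : ℝ} (ha : 0 ≤ a) (k : ℕ) :
    (1 + a ^ 2) ^ ((k : ℝ) / 2) ≤ (1 + a) ^ k := by
  rw [one_add_sq_rpow_eq]
  refine pow_le_pow_left₀ (Real.sqrt_nonneg _) ?_ k
  exact Real.sqrt_le_iff.mpr ⟨by positivity, by nlinarith⟩

lemma KU.norm_le (Φ : KU n) (x : RSp n) {k : ℕ} {z : CSp n} (hz : z ∈ tube n k) :
    ‖Φ x z‖ * (1 + ‖z‖) ^ k * Real.exp (k * ‖x‖) ≤ 2 ^ k * rho n k Φ := by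
  have h := Φ.wderU_le_rho (Nat.zero_le k) x hz
  unfold wderU wder at h
  rw [norm_iteratedFDeriv_zero] at h
  calc _ ≤ ‖Φ x z‖ * (2 ^ k * (1 + ‖z‖ ^ 2) ^ ((k : ℝ) / 2)) * Real.exp (k * ‖x‖) := by
        gcongr; exact one_add_pow_le (norm_nonneg z) k
    _ = 2 ^ k * ((1 + ‖z‖ ^ 2) ^ ((k : ℝ) / 2) * (Real.exp (k * ‖x‖) * ‖Φ x z‖)) := by ring
    _ ≤ _ := by gcongr

lemma norm_le_norm_cpt (ξ η : RSp n) : ‖ξ‖ ≤ ‖cpt ξ η‖ := by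
  rw [EuclideanSpace.norm_eq, EuclideanSpace.norm_eq]
  refine Real.sqrt_le_sqrt (Finset.sum_le_sum fun i _ => ?_)
  have : (cpt ξ η i).re = ξ i := by simp [cpt]
  rw [← this, Real.norm_eq_abs]
  exact pow_le_pow_left₀ (abs_nonneg _) (Complex.abs_re_le_norm _) 2

/-- The order of the norms needed to control `ν_k` of the weighted atoms. -/
def order (n k m : ℕ) : ℕ := k + 7 * n * m + (n + 1) + m

/-- The order splits into `k` for the polynomial growth of the atom in `z`, `7 * n * m` for its
exponential growth in `x` beyond `k`, `n + 1` for the weight in either variable, and `m` so that the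
given tube lies in the one used by `rho`. -/
lemma weight_mul_nu_atom_le (Φ : KU n) (ψ : K1 n) (k : ℕ) {m : ℕ} {η : RSp n}
    (p : RSp n × RSp n) (hz : cpt p.2 η ∈ tube n m) :
    weight p * (‖Φ p.1 (cpt p.2 η)‖ * K1.nu n k (atom ψ p.1 (cpt p.2 η))) ≤
      2 ^ k * (7 * n + 1) ^ k * 2 ^ order n k m *
        (KU.rho n (order n k m) Φ * K1.nu n (order n k m) ψ) := by
  obtain ⟨x, ξ⟩ := p
  set z := cpt ξ η with hzdef
  have h1 := nu_atom_le ψ x (k := k) hz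
  have hmM : m ≤ order n k m := by unfold order; omega
  have h2 := Φ.norm_le x (KU.tube_mono hmM hz)
  have h3 : K1.nu n (k + 7 * n * m) ψ ≤ K1.nu n (order n k m) ψ :=
    K1.nu_mono (by unfold order; omega) ψ
  have hν : 0 ≤ K1.nu n (order n k m) ψ := apply_nonneg _ _
  have hν' : 0 ≤ K1.nu n (k + 7 * n * m) ψ := apply_nonneg _ _
  have h4 : (1 + ‖x‖) ^ (n + 1) * Real.exp ((k + 7 * n * m : ℕ) * ‖x‖) ≤
      Real.exp (order n k m * ‖x‖) := by
    have : (1 + ‖x‖) ^ (n + 1) ≤ Real.exp ((n + 1 : ℕ) * ‖x‖) := by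
      rw [Real.exp_nat_mul]
      refine pow_le_pow_left₀ (by positivity) ?_ _
      linarith [Real.add_one_le_exp ‖x‖]
    refine (mul_le_mul_of_nonneg_right this (Real.exp_pos _).le).trans ?_
    rw [← Real.exp_add, ← add_mul]
    gcongr
    norm_cast
    unfold order; omega
  have h5 : (1 + ‖ξ‖) ^ (n + 1) * (1 + ‖z‖) ^ k ≤ (1 + ‖z‖) ^ order n k m := by
    have hn := norm_nonneg z
    calc _ ≤ (1 + ‖z‖) ^ (n + 1) * (1 + ‖z‖) ^ k := by
          gcongr; exact norm_le_norm_cpt ξ η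
      _ = (1 + ‖z‖) ^ (n + 1 + k) := (pow_add _ _ _).symm
      _ ≤ _ := pow_le_pow_right₀ (by linarith) (by unfold order; omega)
  unfold weight
  calc (1 + ‖x‖) ^ (n + 1) * (1 + ‖ξ‖) ^ (n + 1) * (‖Φ x z‖ * K1.nu n k (atom ψ x z))
      ≤ (1 + ‖x‖) ^ (n + 1) * (1 + ‖ξ‖) ^ (n + 1) * (‖Φ x z‖ *
        (2 ^ k * ((Real.exp ((k + 7 * n * m : ℕ) * ‖x‖) * K1.nu n (order n k m) ψ) *
          ((7 * n + 1) ^ k * (1 + ‖z‖) ^ k)))) := by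
        gcongr
        refine h1.trans ?_
        gcongr
    _ = 2 ^ k * (7 * n + 1) ^ k * K1.nu n (order n k m) ψ * (‖Φ x z‖ *
        ((1 + ‖ξ‖) ^ (n + 1) * (1 + ‖z‖) ^ k) *
        ((1 + ‖x‖) ^ (n + 1) * Real.exp ((k + 7 * n * m : ℕ) * ‖x‖))) := by ring
    _ ≤ 2 ^ k * (7 * n + 1) ^ k * K1.nu n (order n k m) ψ * (‖Φ x z‖ *
        (1 + ‖z‖) ^ order n k m * Real.exp (order n k m * ‖x‖)) := by gcongr
    _ ≤ 2 ^ k * (7 * n + 1) ^ k * K1.nu n (order n k m) ψ *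
        (2 ^ order n k m * KU.rho n (order n k m) Φ) := by gcongr
    _ = _ := by ring

/-- Elements of `KU` are only assumed regular in each variable separately. The norm `rho n (m + 1)`,
of order at least one, controls the first `x`-derivative on the tube, so `Φ` is Lipschitz in `x`
uniformly in `ξ`; with continuity in `ξ` this gives joint continuity. -/
lemma KU.continuous_cpt (Φ : KU n) (η : RSp n) :
    Continuous fun p : RSp n × RSp n => Φ p.1 (cpt p.2 η) := by
  obtain ⟨m, hm⟩ := exists_cpt_mem_tube η
  refine continuous_prod_of_continuous_lipschitzWith
    (fun p : RSp n × RSp n => Φ p.1 (cpt p.2 η)) (Real.toNNReal (rho n (m + 1) Φ))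
    (fun x => ((Φ.2.2.1 x).continuous).comp (ExpSTFT.continuous_cpt η)) fun ξ => ?_
  refine lipschitzWith_of_nnnorm_fderiv_le (𝕜 := ℝ)
    ((Φ.2.1 (cpt ξ η)).differentiable (by simp)) fun x => ?_
  rw [← NNReal.coe_le_coe, coe_nnnorm, ← norm_iteratedFDeriv_one]
  refine le_trans ?_ (Real.le_coe_toNNReal _)
  refine le_trans ?_ (Φ.wderU_le_rho (Nat.le_add_left 1 m) x
    (KU.tube_mono (Nat.le_succ m) (hm ξ)))
  unfold wderU wder
  rw [← mul_assoc]
  refine le_mul_of_one_le_left (norm_nonneg _) (one_le_mul_of_one_le_of_one_le ?_ ?_)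
  · exact Real.one_le_rpow (by nlinarith [norm_nonneg (cpt ξ η)]) (by positivity)
  · exact Real.one_le_exp (by positivity)

/-- The integrand `Φ(x, ξ + iη) conj(ψ(· - x)) e^{-2π i (ξ + iη) · ·}`, with values in
`𝒦₁(ℝⁿ)`. -/
def scaledAtom (Φ : KU n) (ψ : K1 n) (η : RSp n) (p : RSp n × RSp n) : K1 n :=
  Φ p.1 (cpt p.2 η) • atom ψ p.1 (cpt p.2 η)

lemma continuous_scaledAtom (Φ : KU n) (ψ : K1 n) (η : RSp n) :
    Continuous (scaledAtom Φ ψ η) :=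
  (Φ.continuous_cpt η).smul (continuous_atom ψ η)

lemma apply_scaledAtom (f : K1Dual n) (Φ : KU n) (ψ : K1 n) (η : RSp n) (p : RSp n × RSp n) :
    f (scaledAtom Φ ψ η p) = stftDist f ψ p.1 (cpt p.2 η) * Φ p.1 (cpt p.2 η) := by
  rw [scaledAtom, map_smul, smul_eq_mul, mul_comm]; rfl

lemma nu_scaledAtom_le (Φ : KU n) (ψ : K1 n) (k : ℕ) {m : ℕ} {η : RSp n} (p : RSp n × RSp n)
    (hz : cpt p.2 η ∈ tube n m) :
    K1.nu n k (scaledAtom Φ ψ η p) ≤ (2 ^ k * (7 * n + 1) ^ k * 2 ^ order n k m *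
        (KU.rho n (order n k m) Φ * K1.nu n (order n k m) ψ)) * (weight p)⁻¹ := by
  rw [scaledAtom, map_smul_eq_mul, ← div_eq_mul_inv, le_div_iff₀ (weight_pos p), mul_comm]
  exact weight_mul_nu_atom_le Φ ψ k p hz

lemma exists_nu_scaledAtom_bound (Φ : KU n) (ψ : K1 n) (η : RSp n) :
    ∃ b : ℕ → RSp n × RSp n → ℝ, (∀ k, Integrable (b k)) ∧
      ∀ k p, K1.nu n k (scaledAtom Φ ψ η p) ≤ b k p := by
  obtain ⟨m, hm⟩ := exists_cpt_mem_tube η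
  exact ⟨_, fun k => integrable_inv_weight.const_mul _,
    fun k p => nu_scaledAtom_le Φ ψ k p (hm p.2)⟩

lemma integrable_stftDist_mul (f : K1Dual n) (ψ : K1 n) (Φ : KU n) (η : RSp n) :
    Integrable fun p : RSp n × RSp n =>
      stftDist f ψ p.1 (cpt p.2 η) * Φ p.1 (cpt p.2 η) := by
  obtain ⟨b, hb, hab⟩ := exists_nu_scaledAtom_bound Φ ψ η
  simp_rw [← apply_scaledAtom]
  exact K1Dual.integrable_comp (continuous_scaledAtom Φ ψ η) hb hab f

lemma apply_eq_integral_stftDist_mul (f : K1Dual n) (ψ : K1 n) (Φ : KU n) (η : RSp n) {g : K1 n}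
    (hg : ∀ t, g t = ∫ p, scaledAtom Φ ψ η p t) :
    f g = ∫ p : RSp n × RSp n, stftDist f ψ p.1 (cpt p.2 η) * Φ p.1 (cpt p.2 η) := by
  obtain ⟨b, hb, hab⟩ := exists_nu_scaledAtom_bound Φ ψ η
  simp_rw [← apply_scaledAtom]
  exact K1Dual.apply_integral (continuous_scaledAtom Φ ψ η) hb hab hg f

/-- Putting the weight inside `f` means that `f` need only be controlled on the weighted atoms.
These range over a bounded set when `Φ` and `ψ` do, so a strong neighbourhood of zero can provide
this control. -/
lemma norm_integral_stftDist_mul_le {f : K1Dual n} {ψ : K1 n} {Φ : KU n} {s : ℝ}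
    (h : ∀ p, ‖f (((weight p : ℝ) : ℂ) • scaledAtom Φ ψ 0 p)‖ ≤ s) :
    ‖∫ p : RSp n × RSp n, stftDist f ψ p.1 (cpt p.2 0) * Φ p.1 (cpt p.2 0)‖ ≤
      (∫ p : RSp n × RSp n, (weight p)⁻¹) * s := by
  rw [← integral_mul_const]
  refine norm_integral_le_of_norm_le (integrable_inv_weight.mul_const s) (.of_forall fun p => ?_)
  have h1 := h p
  rw [map_smul, norm_smul, Complex.norm_real, Real.norm_of_nonneg (weight_pos p).le,
    apply_scaledAtom] at h1
  rwa [le_inv_mul_iff₀ (weight_pos p)]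

lemma cpt_zero_mem_tube (ξ : RSp n) (k : ℕ) : cpt ξ 0 ∈ tube n k := fun i => by simp [cpt]

lemma nu_weight_smul_scaledAtom_le (Φ : KU n) (ψ : K1 n) (k : ℕ) (p : RSp n × RSp n) :
    K1.nu n k (((weight p : ℝ) : ℂ) • scaledAtom Φ ψ 0 p) ≤
      2 ^ k * (7 * n + 1) ^ k * 2 ^ order n k 0 *
        (KU.rho n (order n k 0) Φ * K1.nu n (order n k 0) ψ) := by
  rw [map_smul_eq_mul, Complex.norm_real, Real.norm_of_nonneg (weight_pos p).le, scaledAtom,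
    map_smul_eq_mul]
  exact weight_mul_nu_atom_le Φ ψ k p (cpt_zero_mem_tube _ _)

lemma norm_integral_stftDist_mul_le_of_bound {f : K1Dual n} {k : ℕ} {C : ℝ} (hC : 0 ≤ C)
    (hf : ∀ φ, ‖f φ‖ ≤ C * K1.nu n k φ) (ψ : K1 n) (Φ : KU n) :
    ‖∫ p : RSp n × RSp n, stftDist f ψ p.1 (cpt p.2 0) * Φ p.1 (cpt p.2 0)‖ ≤
      (∫ p : RSp n × RSp n, (weight p)⁻¹) * (C * (2 ^ k * (7 * n + 1) ^ k * 2 ^ order n k 0 *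
        (KU.rho n (order n k 0) Φ * K1.nu n (order n k 0) ψ))) :=
  norm_integral_stftDist_mul_le fun p => (hf _).trans
    (mul_le_mul_of_nonneg_left (nu_weight_smul_scaledAtom_le Φ ψ k p) hC)

/-! ### The STFT as a sesquilinear map -/

lemma atom_add (ψ χ : K1 n) (x : RSp n) (z : CSp n) :
    atom (ψ + χ) x z = atom ψ x z + atom χ x z := K1.ext fun t => by
  change conj ((ψ + χ) (t - x)) * cexpo z t =
    conj (ψ (t - x)) * cexpo z t + conj (χ (t - x)) * cexpo z t
  rw [K1.add_apply, map_add, add_mul]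

lemma atom_smul (c : ℂ) (ψ : K1 n) (x : RSp n) (z : CSp n) :
    atom (c • ψ) x z = conj c • atom ψ x z := K1.ext fun t => by
  change conj ((c • ψ) (t - x)) * cexpo z t = conj c * (conj (ψ (t - x)) * cexpo z t)
  rw [K1.smul_apply, map_mul, mul_assoc]

/-- The linear form `Φ ↦ ∬ V_ψ f(x, ξ) Φ(x, ξ) dx dξ`. -/
def stftLinearForm (f : K1Dual n) (ψ : K1 n) : KU n →ₗ[ℂ] ℂ where
  toFun Φ := ∫ p : RSp n × RSp n, stftDist f ψ p.1 (cpt p.2 0) * Φ p.1 (cpt p.2 0)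
  map_add' Φ Ψ := by
    rw [← integral_add (integrable_stftDist_mul f ψ Φ 0) (integrable_stftDist_mul f ψ Ψ 0)]
    simp only [KU.add_apply, mul_add]
  map_smul' c Φ := by
    rw [RingHom.id_apply, smul_eq_mul, ← integral_const_mul]
    simp only [KU.smul_apply, mul_left_comm]

lemma continuous_stftLinearForm (f : K1Dual n) (ψ : K1 n) : Continuous (stftLinearForm f ψ) := by
  obtain ⟨k, C, hC, hf⟩ := exists_bound_of_continuous (K1.withSeminorms n) K1.nu_mono f
  refine continuous_of_bound (KU.withSeminorms n) (stftLinearForm f ψ) (order n k 0)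
    ((∫ p : RSp n × RSp n, (weight p)⁻¹) * (C * (2 ^ k * (7 * n + 1) ^ k * 2 ^ order n k 0 *
      K1.nu n (order n k 0) ψ))) fun Φ => ?_
  refine (norm_integral_stftDist_mul_le_of_bound hC hf ψ Φ).trans_eq ?_
  have : KU.rhoFamily n (order n k 0) Φ = KU.rho n (order n k 0) Φ := rfl
  rw [this]
  ring

/-- The continuous functional `Φ ↦ ∬ V_ψ f(x, ξ) Φ(x, ξ) dx dξ`. -/
def stftFunctional (f : K1Dual n) (ψ : K1 n) : KUDual n :=
  ⟨stftLinearForm f ψ, continuous_stftLinearForm f ψ⟩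

lemma stftFunctional_apply (f : K1Dual n) (ψ : K1 n) (Φ : KU n) : stftFunctional f ψ Φ =
    ∫ p : RSp n × RSp n, stftDist f ψ p.1 (cpt p.2 0) * Φ p.1 (cpt p.2 0) := rfl

/-- The STFT `(f, ψ) ↦ V_ψ f`. -/
def stftMap (n : ℕ) : K1Dual n →ₗ[ℂ] K1 n →ₗ⋆[ℂ] KUDual n :=
  LinearMap.mk₂'ₛₗ (RingHom.id ℂ) (starRingEnd ℂ) stftFunctional
    (fun f g ψ => ContinuousLinearMap.ext fun Φ => by
      rw [_root_.add_apply, stftFunctional_apply, stftFunctional_apply, stftFunctional_apply,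
        ← integral_add (integrable_stftDist_mul f ψ Φ 0) (integrable_stftDist_mul g ψ Φ 0)]
      simp only [stftDist, _root_.add_apply, add_mul])
    (fun c f ψ => ContinuousLinearMap.ext fun Φ => by
      rw [_root_.smul_apply, stftFunctional_apply, stftFunctional_apply, smul_eq_mul,
        RingHom.id_apply, ← integral_const_mul]
      simp only [stftDist, _root_.smul_apply, smul_eq_mul, mul_assoc])
    (fun f ψ χ => ContinuousLinearMap.ext fun Φ => by
      rw [_root_.add_apply, stftFunctional_apply, stftFunctional_apply, stftFunctional_apply,
        ← integral_add (integrable_stftDist_mul f ψ Φ 0) (integrable_stftDist_mul f χ Φ 0)]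
      simp only [stftDist, atom_add, map_add, add_mul])
    (fun c f ψ => ContinuousLinearMap.ext fun Φ => by
      rw [_root_.smul_apply, stftFunctional_apply, stftFunctional_apply, smul_eq_mul,
        ← integral_const_mul]
      simp only [stftDist, atom_smul, map_smul, smul_eq_mul, mul_assoc])

lemma exists_pos_mul_lt (A : ℝ) {ε : ℝ} (hε : 0 < ε) : ∃ δ > 0, A * δ < ε := by
  refine ⟨ε / (|A| + 1), by positivity, ?_⟩
  rw [← mul_div_assoc, div_lt_iff₀ (by positivity)]
  nlinarith [le_abs_self A, abs_nonneg A]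

lemma exists_bound_of_vonN {E : Type*} [AddCommGroup E] [Module ℂ E] [TopologicalSpace E]
    {p : SeminormFamily ℂ E ℕ} (hp : WithSeminorms p) {S : Set E}
    (hS : Bornology.IsVonNBounded ℂ S) (k : ℕ) : ∃ r > 0, ∀ x ∈ S, p k x ≤ r := by
  obtain ⟨r, hr, h⟩ := hp.isVonNBounded_iff_seminorm_bounded.mp hS k
  exact ⟨r, hr, fun x hx => (h x hx).le⟩

lemma isHypocontinuous_stftMap : IsHypocontinuous fun (f : K1Dual n) ψ => stftMap n f ψ := by
  have hw : 0 ≤ ∫ p : RSp n × RSp n, (weight p)⁻¹ :=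
    integral_nonneg fun p => inv_nonneg.mpr (weight_pos p).le
  constructor
  · intro B hB W hW
    -- One order and one constant serve all `f ∈ B`, after which smallness has to come from the norm
    -- of `ψ` alone.
    obtain ⟨k, C, hC, hf⟩ := exists_bound_of_isVonNBounded (K1.withSeminorms n) K1.nu_mono hB
    obtain ⟨S, ε, hS, hε, hSW⟩ := exists_bounded_of_mem_nhds hW
    obtain ⟨r, hr, hSr⟩ := exists_bound_of_vonN (KU.withSeminorms n) hS (order n k 0)
    obtain ⟨δ, hδ, hlt⟩ := exists_pos_mul_lt ((∫ p : RSp n × RSp n, (weight p)⁻¹) *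
      (C * (2 ^ k * (7 * n + 1) ^ k * 2 ^ order n k 0 * r))) hε
    refine ⟨_, mem_nhds_of_bound (K1.withSeminorms n) (order n k 0) hδ, fun f hfB ψ hψ =>
      hSW _ fun Φ hΦ => ?_⟩
    refine ((norm_integral_stftDist_mul_le_of_bound hC (hf f hfB) ψ Φ).trans ?_).trans_lt hlt
    have h1 : KU.rho n (order n k 0) Φ ≤ r := hSr Φ hΦ
    have h2 : K1.nu n (order n k 0) ψ ≤ δ := le_of_lt hψ
    calc _ ≤ (∫ p : RSp n × RSp n, (weight p)⁻¹) * (C * (2 ^ k * (7 * n + 1) ^ k *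
          2 ^ order n k 0 * (r * δ))) := by gcongr
      _ = _ := by ring
  · intro B hB W hW
    obtain ⟨S, ε, hS, hε, hSW⟩ := exists_bounded_of_mem_nhds hW
    obtain ⟨δ, hδ, hlt⟩ := exists_pos_mul_lt (∫ p : RSp n × RSp n, (weight p)⁻¹) hε
    -- All weighted atoms that can occur; boundedness of `S'` turns smallness of `f` on it into a
    -- strong neighbourhood of zero independent of `ψ ∈ B`.
    let S' : Set (K1 n) := {χ | ∃ ψ ∈ B, ∃ Φ ∈ S, ∃ p,
      χ = ((weight p : ℝ) : ℂ) • scaledAtom Φ ψ 0 p}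
    have hS' : Bornology.IsVonNBounded ℂ S' := by
      rw [(K1.withSeminorms n).isVonNBounded_iff_seminorm_bddAbove]
      intro k
      obtain ⟨r, hr, hSr⟩ := exists_bound_of_vonN (KU.withSeminorms n) hS (order n k 0)
      obtain ⟨s, hs, hBs⟩ := exists_bound_of_vonN (K1.withSeminorms n) hB (order n k 0)
      refine ⟨2 ^ k * (7 * n + 1) ^ k * 2 ^ order n k 0 * (r * s), ?_⟩
      rintro _ ⟨_, ⟨ψ, hψ, Φ, hΦ, p, rfl⟩, rfl⟩
      have h1 : KU.rho n (order n k 0) Φ ≤ r := hSr Φ hΦ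
      have h2 : K1.nu n (order n k 0) ψ ≤ s := hBs ψ hψ
      refine (nu_weight_smul_scaledAtom_le Φ ψ k p).trans ?_
      gcongr
    refine ⟨_, mem_nhds_of_isVonNBounded hS' hδ, fun ψ hψ f hf => hSW _ fun Φ hΦ => ?_⟩
    exact (norm_integral_stftDist_mul_le fun p => (hf _ ⟨ψ, hψ, Φ, hΦ, p, rfl⟩).le).trans_lt hlt

/-! ### Modulated and reflected test functions -/

/-- Spending `n + 1` orders of exponential decay buys a factor integrable over `ℝⁿ`. -/
lemma exp_neg_le_decay (k : ℕ) (t : RSp n) :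
    Real.exp (-((k + (n + 1) : ℕ) * ‖t‖)) ≤ Real.exp (-(k * ‖t‖)) * decay t := by
  have h1 : (1 + ‖t‖) ^ (n + 1) ≤ Real.exp ((n + 1 : ℕ) * ‖t‖) := by
    rw [Real.exp_nat_mul]
    exact pow_le_pow_left₀ (by positivity) (by linarith [Real.add_one_le_exp ‖t‖]) _
  have h2 : Real.exp (-((k + (n + 1) : ℕ) * ‖t‖)) =
      Real.exp (-(k * ‖t‖)) * (Real.exp ((n + 1 : ℕ) * ‖t‖))⁻¹ := by
    rw [← Real.exp_neg, ← Real.exp_add]; congr 1; push_cast; ring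
  rw [h2, decay]
  gcongr

lemma K1.norm_iteratedFDeriv_le_decay (φ : K1 n) {j k : ℕ} (hj : j ≤ k + (n + 1)) (t : RSp n) :
    ‖iteratedFDeriv ℝ j φ t‖ ≤ nu n (k + (n + 1)) φ * (Real.exp (-(k * ‖t‖)) * decay t) :=
  (φ.norm_iteratedFDeriv_le hj t).trans
    (mul_le_mul_of_nonneg_left (exp_neg_le_decay k t) (apply_nonneg _ _))

lemma K1.norm_le_decay (φ : K1 n) (k : ℕ) (t : RSp n) :
    ‖φ t‖ ≤ nu n (k + (n + 1)) φ * (Real.exp (-(k * ‖t‖)) * decay t) := by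
  simpa using φ.norm_iteratedFDeriv_le_decay (j := 0) (k := k) (Nat.zero_le _) t

lemma K1.integrable (φ : K1 n) : Integrable φ := by
  refine (integrable_decay.const_mul (nu n (0 + (n + 1)) φ)).mono'
    φ.continuous.aestronglyMeasurable (.of_forall fun t => ?_)
  simpa using φ.norm_le_decay 0 t

lemma K1.norm_le_nu (φ : K1 n) (k : ℕ) (t : RSp n) : ‖φ t‖ ≤ nu n k φ :=
  (φ.norm_le k t).trans (mul_le_of_le_one_right (apply_nonneg _ _)
    (Real.exp_le_one_iff.mpr (by have := norm_nonneg t; simp; positivity)))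

lemma exists_mem_tube (z : CSp n) : ∃ m : ℕ, ∀ w : CSp n, ‖w - z‖ ≤ 1 → w ∈ tube n m := by
  obtain ⟨m, hm⟩ := exists_nat_ge (‖z‖ + 1)
  refine ⟨m, fun w hw i => ?_⟩
  have h1 : ‖w‖ ≤ ‖z‖ + 1 := by
    have := norm_add_le (w - z) z
    rw [sub_add_cancel] at this
    linarith
  exact (Complex.abs_im_le_norm _).trans ((PiLp.norm_apply_le w i).trans (h1.trans hm))

lemma neg_mem_tube {z : CSp n} {m : ℕ} (h : z ∈ tube n m) : -z ∈ tube n m := fun i => by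
  simpa using h i

lemma wder_mul_cexpo_le_nu (φ : K1 n) (k : ℕ) {m : ℕ} {z : CSp n} (hz : z ∈ tube n m) {j : ℕ}
    (hj : j ≤ k) (t : RSp n) : wder k (fun t => φ t * cexpo z t) j t ≤
      2 ^ k * (K1.nu n (k + 7 * n * m) φ * ((7 * n + 1) ^ k * (1 + ‖z‖) ^ k)) :=
  wder_mul_cexpo_le φ.contDiff hz (apply_nonneg _ _)
    (fun i hi s => φ.norm_iteratedFDeriv_le (by omega) s) hj t

/-- The test function `φ(t) e^{-2π i z · t}`. -/
def K1.modulate (φ : K1 n) (z : CSp n) : K1 n :=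
  ⟨fun t => φ t * cexpo z t, φ.contDiff.mul (contDiff_cexpo z), fun k => by
    obtain ⟨m, hm⟩ := exists_mem_tube z
    exact ⟨_, fun j hj t => wder_mul_cexpo_le_nu φ k (hm z (by simp)) hj t⟩⟩

lemma K1.modulate_apply (φ : K1 n) (z : CSp n) (t : RSp n) :
    φ.modulate z t = φ t * cexpo z t := rfl

lemma K1.nu_modulate_le (φ : K1 n) (k : ℕ) {m : ℕ} {z : CSp n} (hz : z ∈ tube n m) :
    nu n k (φ.modulate z) ≤
      2 ^ k * (nu n (k + 7 * n * m) φ * ((7 * n + 1) ^ k * (1 + ‖z‖) ^ k)) :=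
  nu_le fun _ hj t => wder_mul_cexpo_le_nu φ k hz hj t

lemma norm_iteratedFDeriv_comp_const_sub {F : Type*} [NormedAddCommGroup F] [NormedSpace ℝ F]
    (g : RSp n → F) (j : ℕ) (x t : RSp n) :
    ‖iteratedFDeriv ℝ j (fun t => g (x - t)) t‖ = ‖iteratedFDeriv ℝ j g (x - t)‖ := by
  have h1 : (fun t => g (x - t)) = fun t => (g ∘ LinearIsometryEquiv.neg ℝ) (t - x) := by
    funext t; simp
  rw [h1, iteratedFDeriv_comp_sub, LinearIsometryEquiv.norm_iteratedFDeriv_comp_right]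
  simp

/-- The Fourier estimate differentiates in `t` an integrand that already contains a `j`-th
derivative of the window; this identifies the result as a derivative of order `i + j`. -/
lemma norm_iteratedFDeriv_iteratedFDeriv {E F : Type*} [NormedAddCommGroup E] [NormedSpace ℝ E]
    [NormedAddCommGroup F] [NormedSpace ℝ F] (g : E → F) (i j : ℕ) (t : E) :
    ‖iteratedFDeriv ℝ i (iteratedFDeriv ℝ j g) t‖ = ‖iteratedFDeriv ℝ (i + j) g t‖ := by
  induction j generalizing i with
  | zero =>
    rw [iteratedFDeriv_zero_eq_comp, LinearIsometryEquiv.norm_iteratedFDeriv_comp_left]; rfl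
  | succ j ih =>
    let e : (E →L[ℝ] E [×j]→L[ℝ] F) ≃ₗᵢ[ℝ] (E [×(j + 1)]→L[ℝ] F) :=
      (continuousMultilinearCurryLeftEquiv ℝ (fun _ : Fin (j + 1) => E) F).symm
    have h1 : iteratedFDeriv ℝ (j + 1) g = e ∘ fderiv ℝ (iteratedFDeriv ℝ j g) :=
      iteratedFDeriv_succ_eq_comp_left
    have h2 := e.norm_iteratedFDeriv_comp_left (𝕜 := ℝ) (fderiv ℝ (iteratedFDeriv ℝ j g)) t i
    rw [h1, h2, norm_iteratedFDeriv_fderiv, ih, add_right_comm, add_assoc]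

/-- The reflected test function `φ(-t)`. -/
def K1.reflect (φ : K1 n) : K1 n :=
  -- Written as `0 - t` so that `norm_iteratedFDeriv_comp_const_sub` applies with `x = 0`.
  ⟨fun t => φ (0 - t), φ.contDiff.comp (contDiff_const.sub contDiff_id), fun k => by
    refine ⟨nu n k φ, fun j hj t => ?_⟩
    unfold wder
    rw [norm_iteratedFDeriv_comp_const_sub]
    simpa [wder] using φ.wder_le_nu hj (0 - t)⟩

lemma K1.reflect_apply (φ : K1 n) (t : RSp n) : φ.reflect t = φ (-t) :=
  congrArg φ (zero_sub t)

lemma K1.nu_reflect_le (φ : K1 n) (k : ℕ) : nu n k φ.reflect ≤ nu n k φ :=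
  nu_le fun j hj t => by
    have h : wder k φ.reflect j t = wder k φ j (0 - t) := by
      unfold wder
      rw [← norm_iteratedFDeriv_comp_const_sub]
      simp [K1.reflect]
      rfl
    rw [h]
    exact φ.wder_le_nu hj _

/-! ### The kernel of the adjoint STFT -/

/-- The function `∫ φ(t) ψ(t - x) e^{2π i z · t} dt`. -/
def synthFun (ψ φ : K1 n) (x : RSp n) (z : CSp n) : ℂ :=
  ∫ t, φ.modulate (-z) t * ψ (t - x)

lemma integrable_synth (ψ φ : K1 n) (x : RSp n) :
    Integrable fun t => φ t * ψ (t - x) := by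
  refine (φ.integrable.norm.mul_const (K1.nu n 0 ψ)).mono'
    (φ.continuous.mul (ψ.continuous.comp (continuous_id.sub continuous_const))).aestronglyMeasurable
    (.of_forall fun t => ?_)
  rw [norm_mul]
  exact mul_le_mul_of_nonneg_left (ψ.norm_le_nu 0 _) (norm_nonneg _)

lemma cexpo_add (z w : CSp n) (t : RSp n) : cexpo (z + w) t = cexpo z t * cexpo w t := by
  rw [cexpo, cexpo, cexpo, ← Complex.exp_add, ← mul_add]
  congr 2
  simp only [cdot, PiLp.add_apply, add_mul, Finset.sum_add_distrib]

lemma cexpo_zero (t : RSp n) : cexpo (0 : CSp n) t = 1 := by simp [cexpo, cdot]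

lemma cexpo_mul_cexpo_neg (z : CSp n) (t : RSp n) : cexpo z t * cexpo (-z) t = 1 := by
  rw [← cexpo_add, add_neg_cancel, cexpo_zero]

lemma cpt_eq_add (ξ η : RSp n) : cpt ξ η = cpt ξ 0 + cpt 0 η := by
  ext i; simp [cpt]

lemma cexpo_cpt_zero (ξ t : RSp n) :
    cexpo (cpt ξ 0) t = Complex.exp (((-2 * Real.pi * inner ℝ ξ t : ℝ) : ℂ) * Complex.I) := by
  rw [cexpo]
  congr 1
  simp only [cdot, cpt, PiLp.inner_apply]
  push_cast
  simp only [PiLp.zero_apply, Complex.ofReal_zero, zero_mul, add_zero, RCLike.inner_apply,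
    conj_trivial, Complex.ofReal_mul]
  have : ∑ i, (ξ i : ℂ) * (t i : ℂ) = ∑ i, (t i : ℂ) * (ξ i : ℂ) :=
    Finset.sum_congr rfl fun i _ => mul_comm _ _
  rw [this]
  ring

/-- The function whose inverse Fourier transform is an `x`-derivative of `synthFun`. -/
def synthIntegrand (ψ φ : K1 n) (η : RSp n) (j : ℕ) (x t : RSp n) :
    (RSp n) [×j]→L[ℝ] ℂ :=
  φ.modulate (-cpt 0 η) t • iteratedFDeriv ℝ j ψ.reflect (x - t)

lemma contDiff_synthIntegrand (ψ φ : K1 n) (η : RSp n) (j : ℕ) (x : RSp n) :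
    ContDiff ℝ ∞ (synthIntegrand ψ φ η j x) := by
  have h : ContDiff ℝ ∞ (iteratedFDeriv ℝ j ψ.reflect) :=
    ψ.reflect.contDiff.iteratedFDeriv_right (by exact_mod_cast le_top)
  exact (φ.modulate _).contDiff.smul (h.comp (contDiff_const.sub contDiff_id))

/-- In the Leibniz rule the modulated `φ` gives `e^{-k|t|}` and an integrable factor, the window
gives `e^{-k|x - t|}`, and the product of the exponentials is at most `e^{-k|x|}`. The window
carries up to `i + j ≤ k + k` derivatives. -/
lemma norm_iteratedFDeriv_synthIntegrand_le (ψ φ : K1 n) (η : RSp n) {j k i : ℕ} (hj : j ≤ k)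
    (hi : i ≤ k) (x t : RSp n) : ‖iteratedFDeriv ℝ i (synthIntegrand ψ φ η j x) t‖ ≤
      2 ^ k * (K1.nu n (k + (n + 1)) (φ.modulate (-cpt 0 η)) * K1.nu n (k + k) ψ) *
        Real.exp (-(k * ‖x‖)) * decay t := by
  have h : ContDiff ℝ ∞ (iteratedFDeriv ℝ j ψ.reflect) :=
    ψ.reflect.contDiff.iteratedFDeriv_right (by exact_mod_cast le_top)
  have h' : ContDiff ℝ ∞ (fun t => iteratedFDeriv ℝ j ψ.reflect (x - t)) :=
    h.comp (contDiff_const.sub contDiff_id)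
  have hν := apply_nonneg (K1.nu n (k + (n + 1))) (φ.modulate (-cpt 0 η))
  have hν' := apply_nonneg (K1.nu n (k + k)) ψ
  have hd := decay_nonneg t
  refine (norm_iteratedFDeriv_smul_le (φ.modulate (-cpt 0 η)).contDiff h' t
    (by exact_mod_cast le_top)).trans ?_
  refine (sum_choose_mul_le hi
    (v := fun l => ‖iteratedFDeriv ℝ l (fun t => iteratedFDeriv ℝ j ψ.reflect (x - t)) t‖)
    (fun l => norm_nonneg (iteratedFDeriv ℝ l (φ.modulate (-cpt 0 η)) t))
    (A := K1.nu n (k + (n + 1)) (φ.modulate (-cpt 0 η)) * (Real.exp (-(k * ‖t‖)) * decay t))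
    (B := K1.nu n (k + k) ψ * Real.exp (-(k * ‖x - t‖)))
    (by positivity) (fun l hl => ?_) fun l hl => ?_).trans ?_
  · exact K1.norm_iteratedFDeriv_le_decay _ (by omega) t
  · rw [norm_iteratedFDeriv_comp_const_sub, norm_iteratedFDeriv_iteratedFDeriv]
    refine (ψ.reflect.norm_iteratedFDeriv_le (k := k + k) (by omega) _).trans ?_
    refine mul_le_mul (ψ.nu_reflect_le _) (Real.exp_le_exp.mpr ?_) (Real.exp_pos _).le hν'
    push_cast
    nlinarith [mul_nonneg (Nat.cast_nonneg k : (0 : ℝ) ≤ k) (norm_nonneg (x - t))]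
  · rw [max_eq_left (by positivity)]
    have h1 := exp_neg_norm_sub_le k t x
    have h2 : Real.exp (-(k * ‖t‖)) * Real.exp (-(k * ‖x - t‖)) ≤ Real.exp (-(k * ‖x‖)) := by
      calc _ ≤ Real.exp (-(k * ‖t‖)) * (Real.exp (k * ‖t‖) * Real.exp (-(k * ‖x‖))) := by gcongr
        _ = _ := by rw [← mul_assoc, ← Real.exp_add]; simp
    calc _ = 2 ^ k * (K1.nu n (k + (n + 1)) (φ.modulate (-cpt 0 η)) * K1.nu n (k + k) ψ) *
          (Real.exp (-(k * ‖t‖)) * Real.exp (-(k * ‖x - t‖))) * decay t := by ring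
      _ ≤ _ := by gcongr

lemma integrable_iteratedFDeriv_synthIntegrand (ψ φ : K1 n) (η : RSp n) (j i : ℕ) (x : RSp n) :
    Integrable (iteratedFDeriv ℝ i (synthIntegrand ψ φ η j x)) :=
  haveI : SecondCountableTopologyEither (RSp n) ((RSp n) [×i]→L[ℝ] (RSp n) [×j]→L[ℝ] ℂ) :=
    secondCountableTopologyEither_of_left _ _
  (integrable_decay.const_mul _).mono'
    ((contDiff_synthIntegrand ψ φ η j x).continuous_iteratedFDeriv
      (by exact_mod_cast le_top)).aestronglyMeasurable
    (.of_forall fun t => norm_iteratedFDeriv_synthIntegrand_le ψ φ η (le_max_left j i)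
      (le_max_right j i) x t)

open scoped FourierTransform in
lemma norm_pow_mul_fourierInv_synthIntegrand_le (ψ φ : K1 n) (η : RSp n) {j k i : ℕ} (hj : j ≤ k)
    (hi : i ≤ k) (x ξ : RSp n) : ‖ξ‖ ^ i * ‖𝓕⁻ (synthIntegrand ψ φ η j x) ξ‖ ≤
      2 ^ k * (k + 1) * (2 ^ k * (K1.nu n (k + (n + 1)) (φ.modulate (-cpt 0 η)) *
        K1.nu n (k + k) ψ) * Real.exp (-(k * ‖x‖)) * ∫ t : RSp n, decay t) := by
  have hν := apply_nonneg (K1.nu n (k + (n + 1))) (φ.modulate (-cpt 0 η))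
  have hν' := apply_nonneg (K1.nu n (k + k)) ψ
  have hd : 0 ≤ ∫ t : RSp n, decay t := integral_nonneg decay_nonneg
  -- No `ξ`-derivatives of the transform are needed, hence `K = 0`; the sign of `-ξ` turns the
  -- Fourier transform into its inverse.
  have h := Real.pow_mul_norm_iteratedFDeriv_fourier_le (K := 0) (N := ⊤)
    (contDiff_synthIntegrand ψ φ η j x) (fun a b ha _ => by
      have : a = 0 := by simpa using ha
      subst this
      simpa using (integrable_iteratedFDeriv_synthIntegrand ψ φ η j b x).norm)
    (k := 0) (n := i) le_rfl le_top (-ξ)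
  rw [norm_iteratedFDeriv_zero, norm_neg, ← Real.fourierInv_eq_fourier_neg] at h
  refine h.trans ?_
  simp only [pow_zero, one_mul, CharP.cast_eq_zero, mul_zero, zero_add, Finset.range_one,
    Finset.singleton_product, Finset.sum_map, Function.Embedding.coeFn_mk]
  rw [mul_assoc]
  refine mul_le_mul (pow_le_pow_right₀ (by norm_num) hi) ?_
    (Finset.sum_nonneg fun _ _ => integral_nonneg fun _ => norm_nonneg _) (by positivity)
  calc _ ≤ ∑ _l ∈ Finset.range (i + 1), (2 ^ k * (K1.nu n (k + (n + 1))
        (φ.modulate (-cpt 0 η)) * K1.nu n (k + k) ψ) * Real.exp (-(k * ‖x‖)) *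
          ∫ t : RSp n, decay t) := by
        refine Finset.sum_le_sum fun l hl => ?_
        rw [← integral_const_mul]
        refine integral_mono (integrable_iteratedFDeriv_synthIntegrand ψ φ η j l x).norm
          (integrable_decay.const_mul _) fun t => ?_
        exact norm_iteratedFDeriv_synthIntegrand_le ψ φ η hj
          ((Nat.lt_succ_iff.mp (Finset.mem_range.mp hl)).trans hi) x t
    _ ≤ _ := by
        rw [Finset.sum_const, Finset.card_range, nsmul_eq_mul]
        gcongr
        push_cast
        gcongr

/-- Separates the oscillation in `ξ`, which becomes the Fourier kernel, from the real exponential in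
`η`, which is absorbed into the test function. -/
lemma modulate_neg_cpt (φ : K1 n) (ξ η t : RSp n) : φ.modulate (-cpt ξ η) t =
    Complex.exp (((2 * Real.pi * inner ℝ t ξ : ℝ) : ℂ) * Complex.I) *
      φ.modulate (-cpt 0 η) t := by
  have h1 : -cpt ξ η = cpt (-ξ) 0 + -cpt 0 η := by
    rw [cpt_eq_add, neg_add]
    congr 1
    ext i; simp [cpt]
  rw [K1.modulate_apply, K1.modulate_apply, h1, cexpo_add, cexpo_cpt_zero, inner_neg_left,
    real_inner_comm]
  have : (-2 * Real.pi * -inner ℝ t ξ : ℝ) = 2 * Real.pi * inner ℝ t ξ := by ring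
  rw [this]
  ring

/-! ### Derivatives of the kernel in `x` -/

section Derivative

variable (ψ φ : K1 n) (z : CSp n)

/-- In convolution form all dependence on `x` sits in the reflected window, so `x`-derivatives fall
on it alone. -/
lemma synthFun_eq (x : RSp n) :
    synthFun ψ φ x z = ∫ t, φ.modulate (-z) t * ψ.reflect (x - t) := by
  simp only [synthFun, K1.reflect_apply, neg_sub]

lemma iteratedFDeriv_mul_reflect (c : ℂ) (j : ℕ) (x t : RSp n) :
    iteratedFDeriv ℝ j (fun x => c * ψ.reflect (x - t)) x =
      c • iteratedFDeriv ℝ j ψ.reflect (x - t) := by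
  have h : ContDiff ℝ ∞ fun x => ψ.reflect (x - t) :=
    ψ.reflect.contDiff.comp (contDiff_id.sub contDiff_const)
  have h2 := iteratedFDeriv_const_smul_apply (a := c) (𝕜 := ℝ) (i := j) (x := x)
    (f := fun x => ψ.reflect (x - t)) (h.of_le (by exact_mod_cast le_top)).contDiffAt
  rw [iteratedFDeriv_comp_sub] at h2
  exact h2

lemma synth_dominated :
    (∀ t, ContDiff ℝ ∞ fun x => φ.modulate (-z) t * ψ.reflect (x - t)) ∧
    (∀ j x, AEStronglyMeasurable
      (fun t => iteratedFDeriv ℝ j (fun x => φ.modulate (-z) t * ψ.reflect (x - t)) x) volume) ∧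
    (∀ j, Integrable fun t => ‖φ.modulate (-z) t‖ * K1.nu n j ψ.reflect) ∧
    ∀ j t x, ‖iteratedFDeriv ℝ j (fun x => φ.modulate (-z) t * ψ.reflect (x - t)) x‖ ≤
      ‖φ.modulate (-z) t‖ * K1.nu n j ψ.reflect := by
  refine ⟨fun t => contDiff_const.mul
      (ψ.reflect.contDiff.comp (contDiff_id.sub contDiff_const)), fun j x => ?_,
    fun j => (φ.modulate (-z)).integrable.norm.mul_const _, fun j t x => ?_⟩
  · simp_rw [iteratedFDeriv_mul_reflect]
    have h := ψ.reflect.contDiff.continuous_iteratedFDeriv (m := j) (by exact_mod_cast le_top)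
    exact ((φ.modulate (-z)).continuous.smul
      (h.comp (continuous_const.sub continuous_id))).aestronglyMeasurable
  · rw [iteratedFDeriv_mul_reflect, norm_smul]
    refine mul_le_mul_of_nonneg_left ((ψ.reflect.norm_iteratedFDeriv_le le_rfl _).trans ?_)
      (norm_nonneg _)
    exact mul_le_of_le_one_right (apply_nonneg _ _)
      (Real.exp_le_one_iff.mpr (neg_nonpos.mpr (by positivity)))

lemma contDiff_synthFun : ContDiff ℝ ∞ fun x => synthFun ψ φ x z := by
  simp_rw [synthFun_eq]
  obtain ⟨h1, h2, h3, h4⟩ := synth_dominated ψ φ z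
  exact contDiff_integral h1 h2 h3 h4

lemma iteratedFDeriv_synthFun (j : ℕ) (x : RSp n) :
    iteratedFDeriv ℝ j (fun x => synthFun ψ φ x z) x =
      ∫ t, φ.modulate (-z) t • iteratedFDeriv ℝ j ψ.reflect (x - t) := by
  simp_rw [synthFun_eq]
  obtain ⟨h1, h2, h3, h4⟩ := synth_dominated ψ φ z
  rw [iteratedFDeriv_integral h1 h2 h3 h4]
  simp_rw [iteratedFDeriv_mul_reflect]

end Derivative

open scoped FourierTransform in
lemma iteratedFDeriv_synthFun_eq_fourierInv (ψ φ : K1 n) (ξ η : RSp n) (j : ℕ) (x : RSp n) :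
    iteratedFDeriv ℝ j (fun x => synthFun ψ φ x (cpt ξ η)) x =
      𝓕⁻ (synthIntegrand ψ φ η j x) ξ := by
  rw [iteratedFDeriv_synthFun, Real.fourierInv_eq']
  refine integral_congr_ae (.of_forall fun t => ?_)
  simp only [synthIntegrand]
  rw [modulate_neg_cpt, mul_smul]

lemma exists_cpt_eq (z : CSp n) : ∃ ξ η : RSp n, z = cpt ξ η :=
  ⟨WithLp.toLp 2 fun i => (z i).re, WithLp.toLp 2 fun i => (z i).im, by
    ext i; simp [cpt, Complex.re_add_im]⟩

lemma norm_cpt_le (ξ η : RSp n) : ‖cpt ξ η‖ ≤ ‖ξ‖ + ‖η‖ := by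
  rw [cpt_eq_add]
  refine (norm_add_le _ _).trans (add_le_add (le_of_eq ?_) (le_of_eq ?_)) <;>
  simp [EuclideanSpace.norm_eq, cpt]

lemma norm_le_of_cpt_mem_tube {ξ η : RSp n} {k : ℕ} (h : cpt ξ η ∈ tube n k) :
    ‖η‖ ≤ n * k := by
  have h1 : ∀ i, ‖η i‖ ≤ k := fun i => by simpa [cpt] using h i
  rw [EuclideanSpace.norm_eq]
  refine Real.sqrt_le_iff.mpr ⟨by positivity, ?_⟩
  calc ∑ i, ‖η i‖ ^ 2 ≤ ∑ _i : Fin n, (k : ℝ) ^ 2 :=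
        Finset.sum_le_sum fun i _ => pow_le_pow_left₀ (norm_nonneg _) (h1 i) 2
    _ = n * k ^ 2 := by simp
    _ ≤ n ^ 2 * k ^ 2 := by
        gcongr
        exact_mod_cast Nat.le_self_pow two_ne_zero n
    _ = _ := by ring

/-- The order of the norms needed to control `ρ_k` of the kernel of the adjoint STFT. -/
def synthOrder (n k : ℕ) : ℕ := k + k + (n + 1) + 7 * n * k

/-- The constant in the estimate of `ρ_k` of the kernel of the adjoint STFT. -/
def synthConst (n k : ℕ) : ℝ :=
  (1 + n * k) ^ k * 2 ^ k * (2 * (2 ^ k * (k + 1) * (2 ^ k * (2 ^ (k + (n + 1)) *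
    ((7 * n + 1) ^ (k + (n + 1)) * (1 + n * k) ^ (k + (n + 1)))) * ∫ t : RSp n, decay t)))

/-- Decay in `ξ` and in `x` comes from the Fourier estimate. On the tube `η` is bounded, so the
weight in `z` is comparable to one in `ξ`, and modulation by `η` costs `7 * n * k` orders of `φ`. -/
lemma wderU_synthFun_le (ψ φ : K1 n) {j k : ℕ} (hj : j ≤ k) (x : RSp n) {z : CSp n}
    (hz : z ∈ tube n k) : wderU k (synthFun ψ φ) j x z ≤
      synthConst n k * (K1.nu n (synthOrder n k) ψ * K1.nu n (synthOrder n k) φ) := by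
  obtain ⟨ξ, η, rfl⟩ := exists_cpt_eq z
  have hη := norm_le_of_cpt_mem_tube hz
  have hd : 0 ≤ ∫ t : RSp n, decay t := integral_nonneg decay_nonneg
  have hνψ := apply_nonneg (K1.nu n (synthOrder n k)) ψ
  have hνφ := apply_nonneg (K1.nu n (synthOrder n k)) φ
  have hη0 := norm_nonneg η
  have hξ0 := norm_nonneg ξ
  set D := ‖iteratedFDeriv ℝ j (fun x => synthFun ψ φ x (cpt ξ η)) x‖ with hD
  set Q := K1.nu n (k + (n + 1)) (φ.modulate (-cpt 0 η)) with hQ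
  have hQ0 : 0 ≤ Q := apply_nonneg _ _
  set I := ∫ t : RSp n, decay t with hI
  have hQle : Q ≤ 2 ^ (k + (n + 1)) * (K1.nu n (synthOrder n k) φ *
      ((7 * n + 1) ^ (k + (n + 1)) * (1 + n * k) ^ (k + (n + 1)))) := by
    have hz0 : -cpt 0 η ∈ tube n k := neg_mem_tube fun i => by simpa [cpt] using hz i
    refine (φ.nu_modulate_le (k + (n + 1)) hz0).trans ?_
    have h1 : K1.nu n (k + (n + 1) + 7 * n * k) φ ≤ K1.nu n (synthOrder n k) φ :=
      K1.nu_mono (by unfold synthOrder; omega) φ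
    have h2 : ‖-cpt 0 η‖ ≤ n * k := by
      rw [norm_neg]
      refine (norm_cpt_le 0 η).trans ?_
      simpa using hη
    gcongr
  have hψle : K1.nu n (k + k) ψ ≤ K1.nu n (synthOrder n k) ψ :=
    K1.nu_mono (by unfold synthOrder; omega) ψ
  have hbound : ∀ i ≤ k, ‖ξ‖ ^ i * D ≤ 2 ^ k * (k + 1) *
      (2 ^ k * (Q * K1.nu n (k + k) ψ) * Real.exp (-(k * ‖x‖)) * I) := by
    intro i hi
    rw [hD, iteratedFDeriv_synthFun_eq_fourierInv]
    exact norm_pow_mul_fourierInv_synthIntegrand_le ψ φ η hj hi x ξ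
  -- Reduces the full polynomial weight to the two exponents `0` and `k` of `hbound`.
  have hpow : (1 + ‖ξ‖) ^ k ≤ 2 ^ k * (1 + ‖ξ‖ ^ k) := by
    refine (add_pow_le zero_le_one hξ0 k).trans ?_
    rw [one_pow]
    gcongr
    · norm_num
    · exact Nat.sub_le k 1
  have h1 : (1 + ‖ξ‖) ^ k * D ≤ 2 ^ k * (2 * (2 ^ k * (k + 1) *
      (2 ^ k * (Q * K1.nu n (k + k) ψ) * Real.exp (-(k * ‖x‖)) * I))) := by
    have h0 := hbound 0 (Nat.zero_le k)
    have hk := hbound k le_rfl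
    rw [pow_zero] at h0
    have hD0 : 0 ≤ D := norm_nonneg _
    calc (1 + ‖ξ‖) ^ k * D ≤ 2 ^ k * (1 + ‖ξ‖ ^ k) * D := by gcongr
      _ = 2 ^ k * (1 * D + ‖ξ‖ ^ k * D) := by ring
      _ ≤ _ := by
          refine mul_le_mul_of_nonneg_left ?_ (by positivity)
          rw [two_mul]
          exact add_le_add h0 hk
  have hzpow : (1 + ‖cpt ξ η‖ ^ 2) ^ ((k : ℝ) / 2) ≤ (1 + n * k) ^ k * (1 + ‖ξ‖) ^ k := by
    refine (one_add_sq_rpow_le (norm_nonneg _) k).trans ?_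
    rw [← mul_pow]
    refine pow_le_pow_left₀ (by positivity) ?_ k
    have := norm_cpt_le ξ η
    have hnk : (0 : ℝ) ≤ n * k := by positivity
    nlinarith
  unfold wderU wder
  calc _ ≤ (1 + n * k) ^ k * (1 + ‖ξ‖) ^ k * (Real.exp (k * ‖x‖) * D) := by
        gcongr
    _ = (1 + n * k) ^ k * Real.exp (k * ‖x‖) * ((1 + ‖ξ‖) ^ k * D) := by ring
    _ ≤ (1 + n * k) ^ k * Real.exp (k * ‖x‖) * (2 ^ k * (2 * (2 ^ k * (k + 1) *
        (2 ^ k * (Q * K1.nu n (k + k) ψ) * Real.exp (-(k * ‖x‖)) * I)))) := by gcongr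
    _ = (Real.exp (k * ‖x‖) * Real.exp (-(k * ‖x‖))) * ((1 + n * k) ^ k * 2 ^ k *
        (2 * (2 ^ k * (k + 1) * (2 ^ k * (Q * K1.nu n (k + k) ψ) * I)))) := by ring
    _ = (1 + n * k) ^ k * 2 ^ k *
        (2 * (2 ^ k * (k + 1) * (2 ^ k * (Q * K1.nu n (k + k) ψ) * I))) := by
        rw [← Real.exp_add, add_neg_cancel, Real.exp_zero, one_mul]
    _ ≤ (1 + n * k) ^ k * 2 ^ k * (2 * (2 ^ k * (k + 1) * (2 ^ k * ((2 ^ (k + (n + 1)) *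
        (K1.nu n (synthOrder n k) φ * ((7 * n + 1) ^ (k + (n + 1)) *
          (1 + n * k) ^ (k + (n + 1))))) * K1.nu n (synthOrder n k) ψ) * I))) := by gcongr
    _ = _ := by unfold synthConst; ring

/-- The complex-linear form `z ↦ 2π i z · t`. -/
def dotForm (t : RSp n) : CSp n →L[ℂ] ℂ :=
  ∑ i, (2 * Real.pi * Complex.I * (t i : ℂ)) • (EuclideanSpace.proj i : CSp n →L[ℂ] ℂ)

lemma cexpo_neg_eq (z : CSp n) (t : RSp n) : cexpo (-z) t = Complex.exp (dotForm t z) := by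
  simp only [cexpo, cdot, dotForm, Finset.mul_sum, _root_.sum_apply, _root_.smul_apply,
    PiLp.proj_apply, smul_eq_mul, PiLp.neg_apply]
  congr 1
  exact Finset.sum_congr rfl fun i _ => by ring

lemma continuous_dotForm : Continuous (dotForm : RSp n → CSp n →L[ℂ] ℂ) := by
  unfold dotForm
  fun_prop

lemma norm_dotForm_le (t : RSp n) : ‖dotForm t‖ ≤ 7 * n * ‖t‖ := by
  have hpi : 2 * Real.pi ≤ 7 := by linarith [Real.pi_lt_d2]
  refine ContinuousLinearMap.opNorm_le_bound _ (by positivity) fun z => ?_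
  simp only [dotForm, _root_.sum_apply, _root_.smul_apply]
  calc _ ≤ ∑ _i : Fin n, 7 * ‖t‖ * ‖z‖ := by
        refine norm_sum_le_of_le _ fun i _ => ?_
        rw [norm_smul]
        have h1 : ‖(EuclideanSpace.proj i : CSp n →L[ℂ] ℂ) z‖ ≤ ‖z‖ := PiLp.norm_apply_le z i
        have h2 : ‖2 * (Real.pi : ℂ) * Complex.I * (t i : ℂ)‖ ≤ 7 * ‖t‖ := by
          simp only [norm_mul, Complex.norm_ofNat, Complex.norm_real, Complex.norm_I,
            mul_one, Real.norm_of_nonneg Real.pi_pos.le]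
          exact mul_le_mul hpi (PiLp.norm_apply_le t i) (norm_nonneg _) (by norm_num)
        exact mul_le_mul h2 h1 (norm_nonneg _) (by positivity)
    _ = _ := by simp; ring

lemma differentiable_synthFun (ψ φ : K1 n) (x : RSp n) :
    Differentiable ℂ (synthFun ψ φ x) := by
  intro z₀
  obtain ⟨m, hm⟩ := exists_mem_tube z₀
  -- `7 * n * m` orders beat the exponential on the tube, one more beats the linear factor `|t|`
  -- from the `z`-derivative, and `n + 1` leave an integrable function.
  let C := K1.nu n (7 * n * m + 1 + (n + 1)) φ * K1.nu n 0 ψ * (7 * n)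
  have hcont : ∀ z, Continuous fun t => φ.modulate (-z) t * ψ (t - x) := fun z =>
    (φ.modulate (-z)).continuous.mul (ψ.continuous.comp (continuous_id.sub continuous_const))
  have key := hasFDerivAt_integral_of_dominated_of_fderiv_le (𝕜 := ℂ) (x₀ := z₀)
    (μ := (volume : Measure (RSp n)))
    (F := fun z t => φ.modulate (-z) t * ψ (t - x))
    (F' := fun z t => (φ.modulate (-z) t * ψ (t - x)) • dotForm t)
    (bound := fun t => C * decay t) (Metric.closedBall_mem_nhds z₀ one_pos)
    (.of_forall fun z => (hcont z).aestronglyMeasurable)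
    (integrable_synth ψ (φ.modulate (-z₀)) x)
    ((hcont z₀).smul continuous_dotForm).aestronglyMeasurable
    (.of_forall fun t z hz => ?_) (integrable_decay.const_mul C) (.of_forall fun t z _ => ?_)
  · exact key.differentiableAt
  · have hz' := neg_mem_tube (hm z (by simpa [dist_eq_norm] using hz))
    have hn := norm_nonneg t
    have h1 := φ.norm_le_decay (7 * n * m + 1) t
    have h2 := norm_cexpo_le hz' t
    have h3 : ‖dotForm t‖ ≤ 7 * n * Real.exp ‖t‖ := (norm_dotForm_le t).trans (by
      gcongr; linarith [Real.add_one_le_exp ‖t‖])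
    have h4 := ψ.norm_le_nu 0 (t - x)
    have hd := decay_nonneg t
    have hν := apply_nonneg (K1.nu n (7 * n * m + 1 + (n + 1))) φ
    rw [norm_smul, norm_mul, K1.modulate_apply, norm_mul]
    calc _ ≤ (K1.nu n (7 * n * m + 1 + (n + 1)) φ *
          (Real.exp (-((7 * n * m + 1 : ℕ) * ‖t‖)) * decay t)) *
          Real.exp ((7 * n * m : ℕ) * ‖t‖) * K1.nu n 0 ψ * (7 * n * Real.exp ‖t‖) := by gcongr
      _ = (Real.exp (-((7 * n * m + 1 : ℕ) * ‖t‖)) * Real.exp ((7 * n * m : ℕ) * ‖t‖) *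
          Real.exp ‖t‖) * (C * decay t) := by ring
      _ = C * decay t := by
          rw [← Real.exp_add, ← Real.exp_add]
          have : -(((7 * n * m + 1 : ℕ) : ℝ) * ‖t‖) + ((7 * n * m : ℕ) : ℝ) * ‖t‖ + ‖t‖ = 0 := by
            push_cast; ring
          rw [this, Real.exp_zero, one_mul]
  · have h1 : HasFDerivAt (fun z => φ t * Complex.exp (dotForm t z) * ψ (t - x))
        ((φ t * Complex.exp (dotForm t z) * ψ (t - x)) • dotForm t) z := by
      have := (((dotForm t).hasFDerivAt (x := z)).cexp.const_mul (φ t)).mul_const (ψ (t - x))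
      refine this.congr_fderiv ?_
      ext w
      simp
      ring
    simpa only [K1.modulate_apply, cexpo_neg_eq] using h1

/-- The kernel `∫ φ(t) ψ(t - x) e^{2π i z · t} dt` of the adjoint STFT as an element of
`𝒦₁(ℝⁿ) ⊗̂ 𝒰(ℂⁿ)`. -/
def synth (ψ φ : K1 n) : KU n :=
  ⟨synthFun ψ φ, contDiff_synthFun ψ φ, differentiable_synthFun ψ φ,
    fun _ => ⟨_, fun _ hj x _ hz => wderU_synthFun_le ψ φ hj x hz⟩⟩

lemma synth_apply (ψ φ : K1 n) (x : RSp n) (z : CSp n) : synth ψ φ x z = synthFun ψ φ x z := rfl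

lemma rho_synth_le (ψ φ : K1 n) (k : ℕ) : KU.rho n k (synth ψ φ) ≤
    synthConst n k * (K1.nu n (synthOrder n k) ψ * K1.nu n (synthOrder n k) φ) :=
  KU.rho_le fun _ hj x _ hz => wderU_synthFun_le ψ φ hj x hz

/-! ### The adjoint STFT as a bilinear map -/

lemma modulate_add (φ χ : K1 n) (z : CSp n) (t : RSp n) :
    (φ + χ).modulate z t = φ.modulate z t + χ.modulate z t := by
  simp only [K1.modulate_apply, K1.add_apply, add_mul]

lemma modulate_smul (c : ℂ) (φ : K1 n) (z : CSp n) (t : RSp n) :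
    (c • φ).modulate z t = c * φ.modulate z t := by
  simp only [K1.modulate_apply, K1.smul_apply, mul_assoc]

/-- The kernel of the adjoint STFT as a bilinear map. -/
def synthMap (n : ℕ) : K1 n →ₗ[ℂ] K1 n →ₗ[ℂ] KU n :=
  LinearMap.mk₂ ℂ synth
    (fun ψ χ φ => KU.ext fun x z => by
      rw [KU.add_apply, synth_apply, synth_apply, synth_apply, synthFun, synthFun, synthFun,
        ← integral_add (integrable_synth ψ _ x) (integrable_synth χ _ x)]
      simp only [K1.add_apply, mul_add])
    (fun c ψ φ => KU.ext fun x z => by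
      rw [KU.smul_apply, synth_apply, synth_apply, synthFun, synthFun, ← integral_const_mul]
      simp only [K1.smul_apply, mul_left_comm])
    (fun ψ φ χ => KU.ext fun x z => by
      rw [KU.add_apply, synth_apply, synth_apply, synth_apply, synthFun, synthFun, synthFun,
        ← integral_add (integrable_synth ψ _ x) (integrable_synth ψ _ x)]
      simp only [modulate_add, add_mul])
    (fun c ψ φ => KU.ext fun x z => by
      rw [KU.smul_apply, synth_apply, synth_apply, synthFun, synthFun, ← integral_const_mul]
      simp only [modulate_smul, mul_assoc])

lemma synthMap_apply (ψ φ : K1 n) : synthMap n ψ φ = synth ψ φ := rfl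

lemma norm_apply_synth_le {F : KUDual n} {k : ℕ} {C : ℝ} (hC : 0 ≤ C)
    (hF : ∀ Φ, ‖F Φ‖ ≤ C * KU.rho n k Φ) (ψ φ : K1 n) : ‖F (synth ψ φ)‖ ≤
      C * synthConst n k * K1.nu n (synthOrder n k) ψ * K1.nu n (synthOrder n k) φ := by
  refine (hF _).trans ((mul_le_mul_of_nonneg_left (rho_synth_le ψ φ k) hC).trans_eq ?_)
  ring

lemma continuous_apply_synth (F : KUDual n) (ψ : K1 n) :
    Continuous (F.toLinearMap ∘ₗ synthMap n ψ) := by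
  obtain ⟨k, C, hC, hF⟩ := exists_bound_of_continuous (KU.withSeminorms n) KU.rho_mono F
  exact continuous_of_bound (K1.withSeminorms n) _ (synthOrder n k) _
    fun φ => norm_apply_synth_le hC hF ψ φ

/-- The functional `φ ↦ ⟨F, conj(V_ψ(conj φ))⟩`. -/
def adjointFunctional (F : KUDual n) (ψ : K1 n) : K1Dual n :=
  ⟨F.toLinearMap ∘ₗ synthMap n ψ, continuous_apply_synth F ψ⟩

lemma adjointFunctional_apply (F : KUDual n) (ψ φ : K1 n) :
    adjointFunctional F ψ φ = F (synth ψ φ) := rfl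

/-- The adjoint STFT `(F, ψ) ↦ V_ψ^* F`. -/
def adjointMap (n : ℕ) : KUDual n →ₗ[ℂ] K1 n →ₗ[ℂ] K1Dual n :=
  LinearMap.mk₂ ℂ adjointFunctional
    (fun _ _ _ => rfl) (fun _ _ _ => rfl)
    (fun F ψ χ => ContinuousLinearMap.ext fun φ => by
      rw [_root_.add_apply, adjointFunctional_apply, adjointFunctional_apply,
        adjointFunctional_apply, ← synthMap_apply, map_add, LinearMap.add_apply, map_add]
      rfl)
    (fun c F ψ => ContinuousLinearMap.ext fun φ => by
      rw [_root_.smul_apply, adjointFunctional_apply, adjointFunctional_apply,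
        ← synthMap_apply, map_smul, LinearMap.smul_apply, map_smul]
      rfl)

lemma conj_cexpo_conjPt (z : CSp n) (t : RSp n) : conj (cexpo (conjPt z) t) = cexpo (-z) t := by
  rw [cexpo, cexpo, ← Complex.exp_conj]
  congr 1
  simp [cdot, conjPt, Complex.conj_ofNat]

/-- This reading of the kernel is the one in the definition of the adjoint; `synthFun_eq_stftFun`
gives the one in the reconstruction formula. -/
lemma synthFun_eq_conj_stftFun (ψ φ : K1 n) (x : RSp n) (z : CSp n) :
    synthFun ψ φ x z = conj (stftFun (fun t => conj (φ t)) ψ x (conjPt z)) := by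
  rw [stftFun, ← integral_conj, synthFun]
  refine integral_congr_ae (.of_forall fun t => ?_)
  simp only [map_mul, Complex.conj_conj, conj_cexpo_conjPt, K1.modulate_apply]
  ring

lemma synthFun_eq_stftFun (ψ φ : K1 n) (x : RSp n) (z : CSp n) :
    synthFun ψ φ x z = stftFun φ (fun t => conj (ψ t)) x (-z) := by
  rw [stftFun, synthFun]
  refine integral_congr_ae (.of_forall fun t => ?_)
  simp only [Complex.conj_conj, K1.modulate_apply]
  ring

lemma isAdjointSTFT_adjointMap (F : KUDual n) (ψ : K1 n) : IsAdjointSTFT F ψ (adjointMap n F ψ) :=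
  fun φ => ⟨synth ψ φ, fun x z => synthFun_eq_conj_stftFun ψ φ x z, rfl⟩

lemma isGivenBy_stftMap (f : K1Dual n) (ψ : K1 n) : IsGivenBy (stftMap n f ψ) (stftDist f ψ) :=
  fun Φ => ⟨integrable_stftDist_mul f ψ Φ 0, rfl⟩

lemma synthConst_nonneg (n k : ℕ) : 0 ≤ synthConst n k := by
  have : 0 ≤ ∫ t : RSp n, decay t := integral_nonneg decay_nonneg
  unfold synthConst
  positivity

lemma isHypocontinuous_adjointMap :
    IsHypocontinuous fun (F : KUDual n) ψ => adjointMap n F ψ := by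
  constructor
  · intro B hB W hW
    obtain ⟨k, C, hC, hF⟩ := exists_bound_of_isVonNBounded (KU.withSeminorms n) KU.rho_mono hB
    obtain ⟨S, ε, hS, hε, hSW⟩ := exists_bounded_of_mem_nhds hW
    obtain ⟨r, hr, hSr⟩ := exists_bound_of_vonN (K1.withSeminorms n) hS (synthOrder n k)
    obtain ⟨δ, hδ, hlt⟩ := exists_pos_mul_lt (C * synthConst n k * r) hε
    refine ⟨_, mem_nhds_of_bound (K1.withSeminorms n) (synthOrder n k) hδ, fun F hFB ψ hψ =>
      hSW _ fun φ hφ => ?_⟩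
    have h1 : K1.nu n (synthOrder n k) φ ≤ r := hSr φ hφ
    have h2 : K1.nu n (synthOrder n k) ψ ≤ δ := le_of_lt hψ
    have h3 := synthConst_nonneg n k
    refine ((norm_apply_synth_le hC (hF F hFB) ψ φ).trans ?_).trans_lt hlt
    calc _ ≤ C * synthConst n k * δ * r := by gcongr
      _ = _ := by ring
  · intro B hB W hW
    obtain ⟨S, ε, hS, hε, hSW⟩ := exists_bounded_of_mem_nhds hW
    -- The kernel estimate is bilinear, so bounded sets of windows and test functions yield a
    -- bounded set of kernels; a strong neighbourhood of zero makes `F` small on it.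
    have hS' : Bornology.IsVonNBounded ℂ (Set.image2 synth B S) := by
      rw [(KU.withSeminorms n).isVonNBounded_iff_seminorm_bddAbove]
      intro k
      obtain ⟨r, hr, hSr⟩ := exists_bound_of_vonN (K1.withSeminorms n) hS (synthOrder n k)
      obtain ⟨s, hs, hBs⟩ := exists_bound_of_vonN (K1.withSeminorms n) hB (synthOrder n k)
      refine ⟨synthConst n k * (s * r), ?_⟩
      rintro _ ⟨_, ⟨ψ, hψ, φ, hφ, rfl⟩, rfl⟩
      have h1 : K1.nu n (synthOrder n k) φ ≤ r := hSr φ hφ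
      have h2 : K1.nu n (synthOrder n k) ψ ≤ s := hBs ψ hψ
      have h3 := synthConst_nonneg n k
      refine (rho_synth_le ψ φ k).trans ?_
      gcongr
    exact ⟨_, mem_nhds_of_isVonNBounded hS' hε, fun ψ hψ F hF => hSW _ fun φ hφ =>
      hF _ (Set.mem_image2_of_mem hψ hφ)⟩

/-! ### The reconstruction formula -/

lemma KU.integrable_cpt (Φ : KU n) (x η : RSp n) : Integrable fun ξ : RSp n => Φ x (cpt ξ η) := by
  obtain ⟨m, hm⟩ := exists_cpt_mem_tube η
  refine (integrable_decay.const_mul (2 ^ (m + (n + 1)) * rho n (m + (n + 1)) Φ)).mono'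
    ((Φ.2.2.1 x).continuous.comp (ExpSTFT.continuous_cpt η)).aestronglyMeasurable
    (.of_forall fun ξ => ?_)
  have h := Φ.norm_le x (KU.tube_mono (Nat.le_add_right m (n + 1)) (hm ξ))
  rw [decay, ← div_eq_mul_inv, le_div_iff₀ (by positivity)]
  refine le_trans ?_ h
  have h1 : (1 + ‖ξ‖) ^ (n + 1) ≤ (1 + ‖cpt ξ η‖) ^ (m + (n + 1)) :=
    (pow_le_pow_left₀ (by positivity) (by gcongr; exact norm_le_norm_cpt ξ η) _).trans
      (pow_le_pow_right₀ (by linarith [norm_nonneg (cpt ξ η)]) (by omega))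
  calc _ ≤ ‖Φ x (cpt ξ η)‖ * (1 + ‖cpt ξ η‖) ^ (m + (n + 1)) := by gcongr
    _ ≤ _ := le_mul_of_one_le_right (by positivity) (Real.one_le_exp (by positivity))

open scoped FourierTransform in
lemma synthFun_cpt_eq_fourierInv (ψ φ : K1 n) (x ξ η : RSp n) : synthFun ψ φ x (cpt ξ η) =
    𝓕⁻ (fun t => φ.modulate (-cpt 0 η) t * ψ (t - x)) ξ := by
  rw [synthFun, Real.fourierInv_eq']
  refine integral_congr_ae (.of_forall fun t => ?_)
  simp only [smul_eq_mul]
  rw [modulate_neg_cpt, mul_assoc]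

open scoped FourierTransform in
-- Fourier inversion for `g`: its inverse transform is a slice of an element of `KU`, hence
-- integrable. The factor `e^{-2πi(iη)·t}` then cancels the modulation built into `g`.
lemma integral_synthFun_mul_cexpo (ψ φ : K1 n) (x t η : RSp n) :
    ∫ ξ, synthFun ψ φ x (cpt ξ η) * cexpo (cpt ξ η) t = φ t * ψ (t - x) := by
  set g : RSp n → ℂ := fun t => φ.modulate (-cpt 0 η) t * ψ (t - x) with hg
  have hgc : Continuous g :=
    (φ.modulate _).continuous.mul (ψ.continuous.comp (continuous_id.sub continuous_const))
  have hgi : Integrable g := integrable_synth ψ _ x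
  have hinv : 𝓕⁻ g = fun ξ => synth ψ φ x (cpt ξ η) :=
    funext fun ξ => (synthFun_cpt_eq_fourierInv ψ φ x ξ η).symm
  have hFi : Integrable (𝓕 g) := by
    have h1 : 𝓕 g = fun ξ => synth ψ φ x (cpt (-ξ) η) := by
      funext ξ
      have := congrFun hinv (-ξ)
      rwa [Real.fourierInv_eq_fourier_neg, neg_neg] at this
    rw [h1]
    exact ((synth ψ φ).integrable_cpt x η).comp_neg
  have h := congrFun (hgc.fourier_fourierInv_eq hgi hFi) t
  rw [hinv, Real.fourier_eq'] at h
  have h2 : ∀ ξ, synthFun ψ φ x (cpt ξ η) * cexpo (cpt ξ η) t =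
      (Complex.exp (((-2 * Real.pi * inner ℝ ξ t : ℝ) : ℂ) * Complex.I) •
        synth ψ φ x (cpt ξ η)) * cexpo (cpt 0 η) t := fun ξ => by
    rw [cpt_eq_add ξ η, cexpo_add, cexpo_cpt_zero, smul_eq_mul, ← cpt_eq_add, synth_apply]
    ring
  simp_rw [h2]
  rw [integral_mul_const, h, hg]
  simp only [K1.modulate_apply]
  linear_combination φ t * ψ (t - x) * cexpo_mul_cexpo_neg (cpt 0 η) t

/-- Evaluation at a point, as a functional on `𝒦₁(ℝⁿ)`. -/
def evalDual (t : RSp n) : K1Dual n where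
  toFun φ := φ t
  map_add' _ _ := rfl
  map_smul' _ _ := rfl
  cont := continuous_of_bound (K1.withSeminorms n)
    { toFun := fun φ => φ t, map_add' := fun _ _ => rfl, map_smul' := fun _ _ => rfl } 0 1
    fun φ => by rw [one_mul]; exact φ.norm_le_nu 0 t

/-- By Fubini the `ξ`-integral comes first and yields `φ(t) γ(t - x)` times the conjugate of `ψ(t -
x)`; substituting `s = t - x` leaves the inner product of the windows. -/
lemma integral_scaledAtom_synth (ψ γ φ : K1 n) (η t : RSp n) :
    ∫ p, scaledAtom (synth γ φ) ψ η p t = ipL2 γ ψ * φ t := by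
  -- Evaluation at `t` is itself a continuous functional, so integrability follows from the general
  -- statement about functionals.
  have hint : Integrable fun p => scaledAtom (synth γ φ) ψ η p t := by
    obtain ⟨b, hb, hab⟩ := exists_nu_scaledAtom_bound (synth γ φ) ψ η
    exact K1Dual.integrable_comp (continuous_scaledAtom (synth γ φ) ψ η) hb hab (evalDual t)
  rw [Measure.volume_eq_prod] at hint ⊢
  rw [integral_prod _ hint]
  have h1 : ∀ x, ∫ ξ, scaledAtom (synth γ φ) ψ η (x, ξ) t =
      φ t * (γ (t - x) * conj (ψ (t - x))) := fun x => by
    have h2 : ∀ ξ, scaledAtom (synth γ φ) ψ η (x, ξ) t =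
        conj (ψ (t - x)) * (synthFun γ φ x (cpt ξ η) * cexpo (cpt ξ η) t) := fun ξ => by
      change synthFun γ φ x (cpt ξ η) * (conj (ψ (t - x)) * cexpo (cpt ξ η) t) = _
      ring
    simp_rw [h2]
    rw [integral_const_mul, integral_synthFun_mul_cexpo]
    ring
  simp_rw [h1]
  rw [integral_const_mul, mul_comm, ipL2]
  congr 1
  exact integral_sub_left_eq_self (fun s => γ s * conj (ψ s)) volume t

lemma integral_stftDist_mul_synth (f : K1Dual n) (ψ γ φ : K1 n) (η : RSp n) :
    ∫ p : RSp n × RSp n, stftDist f ψ p.1 (cpt p.2 η) * synth γ φ p.1 (cpt p.2 η) =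
      ipL2 γ ψ * f φ := by
  rw [← apply_eq_integral_stftDist_mul f ψ (synth γ φ) η (g := ipL2 γ ψ • φ)
    fun t => (integral_scaledAtom_synth ψ γ φ η t).symm, map_smul, smul_eq_mul]

end ExpSTFT

end

theorem mainTheorem4 (n : ℕ) :
    ∃ (V : K1Dual n →ₗ[ℂ] K1 n →ₗ⋆[ℂ] KUDual n) (Vs : KUDual n →ₗ[ℂ] K1 n →ₗ[ℂ] K1Dual n),
      (∀ f ψ, IsGivenBy (V f ψ) (stftDist f ψ)) ∧
      (∀ F ψ, IsAdjointSTFT F ψ (Vs F ψ)) ∧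
      IsHypocontinuous (fun f ψ => V f ψ) ∧
      IsHypocontinuous (fun F ψ => Vs F ψ) ∧
      ∀ ψ γ : K1 n, ψ ≠ 0 → ipL2 γ ψ ≠ 0 →
        (∀ f : K1Dual n, (ipL2 γ ψ)⁻¹ • Vs (V f ψ) γ = f) ∧
        ∀ (f : K1Dual n) (φ : K1 n) (η : RSp n),
          Integrable (fun p : RSp n × RSp n => stftDist f ψ p.1 (cpt p.2 η) *
            stftFun φ (fun t => conj (γ t)) p.1 (-cpt p.2 η)) volume ∧
          f φ = (ipL2 γ ψ)⁻¹ * ∫ p : RSp n × RSp n, stftDist f ψ p.1 (cpt p.2 η) *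
            stftFun φ (fun t => conj (γ t)) p.1 (-cpt p.2 η) := by
  refine ⟨stftMap n, adjointMap n, isGivenBy_stftMap, isAdjointSTFT_adjointMap,
    isHypocontinuous_stftMap, isHypocontinuous_adjointMap, fun ψ γ _ hγ => ⟨fun f => ?_,
      fun f φ η => ?_⟩⟩
  · refine ContinuousLinearMap.ext fun φ => ?_
    -- `V_ψ f` acts by integration over real frequencies, so this is the case `η = 0`.
    have h : adjointMap n (stftMap n f ψ) γ φ = ipL2 γ ψ * f φ :=
      integral_stftDist_mul_synth f ψ γ φ 0
    rw [_root_.smul_apply, h, smul_eq_mul, inv_mul_cancel_left₀ hγ]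
  · simp_rw [← synthFun_eq_stftFun, ← synth_apply]
    refine ⟨integrable_stftDist_mul f ψ (synth γ φ) η, ?_⟩
    rw [integral_stftDist_mul_synth, inv_mul_cancel_left₀ hγ]
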